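/- Let $S^1=\mathbb R/\mathbb Z$, let $\mathrm{Dens}(S^1)$ be the space of densities $\rho\,dx$ with $\rho\in C^\infty(S^1)$, $\rho>0$, $\int_{S^1}\rho\,dx=1$, and let $T^*\mathrm{Dens}(S^1)=\mathrm{Dens}(S^1)\times C^\infty(S^1)/\mathbb R$ carry the Sasaki–Fisher–Rao metric $$\bar{\mathsf G}^*_{(\rho dx,[\theta])}\big((\dot\rho,\dot\theta),(\dot\rho,\dot\theta)\big)=\frac14\int_{S^1}\Big(\Big(\frac{\dot\rho}{\rho}\Big)^2+\dot\theta^2\Big)\rho\,dx ,$$ where a tangent vector is represented by $\dot\rho$ with $\int\dot\rho\,dx=0$ and by the representative $\dot\theta$, modulo constants, with $\int\dot\theta\rho\,dx=0$. A geodesic on an open interval $J$ is a smooth curve $\gamma$ in $T^*\mathrm{Dens}(S^1)$ that, on every $[a,b]\subset J$, is a critical point of the energy $\frac12\int_a^b\bar{\mathsf G}^*(\dot\gamma,\dot\gamma)\,dt$ among smooth variations with fixed end points. The two-component Hunter–Saxton (2HS) system for smooth functions $u,\sigma$ on $J\times S^1$ is $$\dot u_{xx}=-2u_xu_{xx}-uu_{xxx}+\sigma\sigma_x,\qquad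 \dot\sigma=-(\sigma u)_x .$$ Let $J\subset\mathbb R$ be an open interval and $t_0\in J$. 1. Let $t\mapsto(\varphi(t),\alpha(t))$, $t\in J$, be a smooth curve of orientation-preserving diffeomorphisms $\varphi(t)$ of $S^1$ and functions $\alpha(t)\in C^\infty(S^1)$, and put $u=\dot\varphi\circ\varphi^{-1}$, $\sigma=\dot\alpha\circ\varphi^{-1}$. Then $(u,\sigma)$ solves the 2HS system on $J$ with $\int_{S^1}\sigma(t_0,x)\,dx=0$ if and only if $t\mapsto(\varphi(t)^*dx,[\alpha(t)])=(\varphi_x(t)\,dx,[\alpha(t)])$ is a geodesic of the Sasaki–Fisher–Rao metric and $\int_{S^1}\sigma(t,x)\,dx=0$ for all $t\in J$. Say that $(u,\sigma)$ generates a curve $\gamma$ in $T^*\mathrm{Dens}(S^1)$ if $\gamma=(\varphi^*dx,[\alpha])$ on $J$ for some curve $(\varphi,\alpha)$ as in 1 with $\dot\varphi=u\circ\varphi$, $\dot\alpha=\sigma\circ\varphi$ and $\varphi(t_0)(0)=0$ (for a lift of $\varphi$ to $\mathbb R$). 2. For every solution $(u,\sigma)$ of the 2HS system on $J$ with $\int_{S^1}\sigma(t_0,x)\,dx=0$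 and every $q\in T^*\mathrm{Dens}(S^1)$, there is a unique curve $\gamma$ on $J$ with $\gamma(t_0)=q$ generated by $(u,\sigma)$, and it is a geodesic. 3. Every geodesic $\gamma$ on $J$ is generated by a unique solution $(u,\sigma)$ of the 2HS system on $J$ with $\int_{S^1}\sigma(t_0,x)\,dx=0$ and $u(t,0)=0$ for all $t\in J$. -/

import Mathlib

open scoped ContDiff

/-- `C^∞(S¹)`, where `S¹ = ℝ/ℤ`: smooth functions on the line with period `1`. -/
def CircleFun : Submodule ℝ (ℝ → ℝ) where
  carrier := {f | ContDiff ℝ ∞ f ∧ Function.Periodic f 1}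
  add_mem' := fun hf hg => ⟨hf.1.add hg.1, hf.2.add hg.2⟩
  zero_mem' := ⟨contDiff_const, fun _ => rfl⟩
  smul_mem' := fun c _ hf => ⟨contDiff_const.smul hf.1, hf.2.smul c⟩

/-- The constant functions on `S¹`. -/
def constCircleFun : Submodule ℝ CircleFun where
  carrier := {f | ∃ c : ℝ, ∀ x, (f : ℝ → ℝ) x = c}
  add_mem' := by
    rintro f g ⟨c, hc⟩ ⟨d, hd⟩
    exact ⟨c + d, fun x => by simp [hc x, hd x]⟩
  zero_mem' := ⟨0, fun _ => rfl⟩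
  smul_mem' := by
    rintro k f ⟨c, hc⟩
    exact ⟨k * c, fun x => by simp [hc x]⟩

/-- `Dens(S¹)`: smooth positive densities `ρ dx` on `S¹` of total mass `1`. -/
def DensCircle : Type :=
  {ρ : CircleFun // (∀ x, 0 < (ρ : ℝ → ℝ) x) ∧ ∫ x in (0 : ℝ)..1, (ρ : ℝ → ℝ) x = 1}

/-- The (smooth) cotangent bundle `T^*Dens(S¹) = Dens(S¹) × C^∞(S¹)/ℝ`. -/
abbrev CotangentDens : Type := DensCircle × (CircleFun ⧸ constCircleFun)

/-- The point `q` of `T^*Dens(S¹)` is `(ρ dx, [θ])`. -/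
def CotangentDens.Represents (q : CotangentDens) (ρ θ : ℝ → ℝ) : Prop :=
  ((q.1.1 : CircleFun) : ℝ → ℝ) = ρ ∧
    ∃ h : CircleFun, (h : ℝ → ℝ) = θ ∧ Submodule.Quotient.mk h = q.2

/-- The Sasaki-Fisher-Rao metric at `(ρ dx, [θ])` on a tangent vector `(ρ' dx, θ')`,
where `∫ ρ' dx = 0` and `θ'` is normalized by `∫ θ' ρ dx = 0`. -/
noncomputable def sasakiFisherRao (ρ ρ' θ' : ℝ → ℝ) : ℝ :=
  (1 / 4) * ∫ x in (0 : ℝ)..1, ((ρ' x / ρ x) ^ 2 + θ' x ^ 2) * ρ x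

/-- The energy over `[a, b]` of the curve `t ↦ (ρ(t) dx, [θ(t)])` in `T^*Dens(S¹)`. The velocity at
time `t` is `(∂ₜρ, ∂ₜθ)`, with `∂ₜθ` made into the representative, modulo constants, whose integral
against `ρ dx` vanishes. -/
noncomputable def sasakiEnergy (a b : ℝ) (ρ θ : ℝ → ℝ → ℝ) : ℝ :=
  (1 / 2) * ∫ t in a..b,
    sasakiFisherRao (ρ t) (fun x => deriv (fun s => ρ s x) t)
      (fun x => deriv (fun s => θ s x) t -
        ∫ y in (0 : ℝ)..1, deriv (fun s => θ s y) t * ρ t y)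

/-- `(ρ, θ)` is a smooth representative on `J` of the curve `γ` in `T^*Dens(S¹)`. -/
def IsSmoothRep (J : Set ℝ) (γ : ℝ → CotangentDens) (ρ θ : ℝ → ℝ → ℝ) : Prop :=
  ContDiffOn ℝ ∞ (fun p : ℝ × ℝ => ρ p.1 p.2) (J ×ˢ Set.univ) ∧
  ContDiffOn ℝ ∞ (fun p : ℝ × ℝ => θ p.1 p.2) (J ×ˢ Set.univ) ∧
  ∀ t ∈ J, (γ t).Represents (ρ t) (θ t)

/-- `(ρ, θ)` is a smooth representative on `S × J` of the family `s ↦ Γ s` of curves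
in `T^*Dens(S¹)`. -/
def IsSmoothFamilyRep (S J : Set ℝ) (Γ : ℝ → ℝ → CotangentDens) (ρ θ : ℝ → ℝ → ℝ → ℝ) : Prop :=
  ContDiffOn ℝ ∞ (fun p : ℝ × ℝ × ℝ => ρ p.1 p.2.1 p.2.2) (S ×ˢ J ×ˢ Set.univ) ∧
  ContDiffOn ℝ ∞ (fun p : ℝ × ℝ × ℝ => θ p.1 p.2.1 p.2.2) (S ×ˢ J ×ˢ Set.univ) ∧
  ∀ s ∈ S, ∀ t ∈ J, (Γ s t).Represents (ρ s t) (θ s t)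

/-- `γ` is, on the open interval `J`, a geodesic of the Sasaki-Fisher-Rao metric on `T^*Dens(S¹)`:
a smooth curve which, on every compact interval `[a, b] ⊆ J`, is a critical point of the energy
among smooth variations with fixed end points. -/
def IsSasakiGeodesic (J : Set ℝ) (γ : ℝ → CotangentDens) : Prop :=
  (∃ ρ θ : ℝ → ℝ → ℝ, IsSmoothRep J γ ρ θ) ∧
  ∀ a ∈ J, ∀ b ∈ J, a < b →
    ∀ ε > 0, ∀ (Γ : ℝ → ℝ → CotangentDens) (ρ θ : ℝ → ℝ → ℝ → ℝ),
      IsSmoothFamilyRep (Set.Ioo (-ε) ε) J Γ ρ θ →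
      (∀ t ∈ J, Γ 0 t = γ t) →
      (∀ s ∈ Set.Ioo (-ε) ε, Γ s a = γ a ∧ Γ s b = γ b) →
      HasDerivAt (fun s => sasakiEnergy a b (ρ s) (θ s)) 0 0

/-- `(u, σ)` is a smooth solution on `J × S¹` of the two-component Hunter-Saxton system. -/
structure IsTwoHSSolution (J : Set ℝ) (u σ : ℝ → ℝ → ℝ) : Prop where
  smooth_u : ContDiffOn ℝ ∞ (fun p : ℝ × ℝ => u p.1 p.2) (J ×ˢ Set.univ)
  smooth_sigma : ContDiffOn ℝ ∞ (fun p : ℝ × ℝ => σ p.1 p.2) (J ×ˢ Set.univ)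
  periodic_u : ∀ t ∈ J, Function.Periodic (u t) 1
  periodic_sigma : ∀ t ∈ J, Function.Periodic (σ t) 1
  eq_u : ∀ t ∈ J, ∀ x : ℝ,
    deriv (fun s => iteratedDeriv 2 (u s) x) t =
      -2 * deriv (u t) x * iteratedDeriv 2 (u t) x - u t x * iteratedDeriv 3 (u t) x +
        σ t x * deriv (σ t) x
  eq_sigma : ∀ t ∈ J, ∀ x : ℝ,
    deriv (fun s => σ s x) t = -deriv (fun y => σ t y * u t y) x

/-- `t ↦ (φ(t), α(t))` is a smooth curve, for `t ∈ J`, of orientation-preserving diffeomorphisms of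
`S¹` (given by lifts to the line) and functions on `S¹`, and its right-trivialized velocity is
`u = φ̇ ∘ φ⁻¹`, `σ = α̇ ∘ φ⁻¹`. -/
structure IsMotion (J : Set ℝ) (φ α u σ : ℝ → ℝ → ℝ) : Prop where
  smooth_phi : ContDiffOn ℝ ∞ (fun p : ℝ × ℝ => φ p.1 p.2) (J ×ˢ Set.univ)
  smooth_alpha : ContDiffOn ℝ ∞ (fun p : ℝ × ℝ => α p.1 p.2) (J ×ˢ Set.univ)
  equivariant_phi : ∀ t ∈ J, ∀ x, φ t (x + 1) = φ t x + 1
  deriv_phi_pos : ∀ t ∈ J, ∀ x, 0 < deriv (φ t) x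
  periodic_alpha : ∀ t ∈ J, Function.Periodic (α t) 1
  velocity_phi : ∀ t ∈ J, ∀ x, deriv (fun s => φ s x) t = u t (φ t x)
  velocity_alpha : ∀ t ∈ J, ∀ x, deriv (fun s => α s x) t = σ t (φ t x)

/-- `γ(t) = (φ(t)^* dx, [α(t)])` for all `t ∈ J`. -/
def LiesOver (J : Set ℝ) (φ α : ℝ → ℝ → ℝ) (γ : ℝ → CotangentDens) : Prop :=
  ∀ t ∈ J, (γ t).Represents (deriv (φ t)) (α t)

/-- The fields `(u, σ)` generate the curve `γ`: `γ = (φ^* dx, [α])` for a motion `(φ, α)` with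
velocity `(u, σ)` such that `φ(t₀)` fixes the base point of `S¹`. -/
def Generates (J : Set ℝ) (t₀ : ℝ) (u σ : ℝ → ℝ → ℝ) (γ : ℝ → CotangentDens) : Prop :=
  ∃ φ α : ℝ → ℝ → ℝ, IsMotion J φ α u σ ∧ φ t₀ 0 = 0 ∧ LiesOver J φ α γ

/-! Write `w = ρ̇/ρ` and let `v` be `θ̇` minus its `ρ`-mean. Integration by parts in time gives the
first variation of the energy: boundary terms, minus the pairing of the variation `(r, q)` with `2ẇ
+ w² - v²` and `2 ∂ₜ(vρ)`, all up to the factor 1/8 (`hasDerivAt_sasakiEnergy`). As `r` has zero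
integral, the geodesic equation says that `2ẇ + w² - v²` is constant in `x` and that `vρ` is
constant in time (`IsSmoothRep.isSasakiGeodesic_iff`).

Along a motion put `ρ = φ_x`, `θ = α`. Then `w = u_x ∘ φ`, and `v = σ ∘ φ` exactly when `σ` has zero
mean. The first expression becomes `(2(u_tx + u u_xx) + u_x² - σ²) ∘ φ`, whose argument has twice
the first 2HS equation as `x`-derivative; the second becomes `((σ_t + (σu)_x) ∘ φ) φ_x`. Since `φ`
is onto and `φ_x > 0`, the two systems agree (`IsMotion.geodesicEquation_iff`). The second 2HS
equation conserves the mean of `σ`, so its vanishing at `t₀` suffices.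

To generate a curve from `(u, σ)`, integrate `u` to a flow. Everything about the flow comes from one
formula: the difference of two trajectories solves a linear equation whose coefficient is the secant
slope of `u`, hence is its initial value times an exponential (`IsTrajectory.sub_eq`). Conversely, a
curve `(ρ dx, [θ])` is lifted by the primitive `φ` of `ρ` vanishing at `0`, with `θ` corrected by a
function of time so that `σ` has zero mean (`IsSmoothRep.exists_isMotion`). Uniqueness holds because
`φ` is determined by its derivative and one value, and `v` does not depend on the representative
`θ`. -/

open scoped NNReal
open Set Filter Topology MeasureTheory

universe v

/-! ### Integrals depending on a parameter -/

/-- Near a point `x₀`, a function continuous on a neighbourhood of `{x₀} × [a, b]` is bounded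
uniformly on `[a, b]`. -/
theorem exists_nhds_bound_of_continuousOn {E F : Type*} [NormedAddCommGroup E]
    [NormedAddCommGroup F] {f : E → ℝ → F} {W : Set (E × ℝ)} (hW : IsOpen W)
    (hf : ContinuousOn (fun p : E × ℝ => f p.1 p.2) W) {a b : ℝ} {x₀ : E}
    (hx₀ : ∀ y ∈ uIcc a b, (x₀, y) ∈ W) :
    ∃ V ∈ 𝓝 x₀, ∃ M : ℝ, ∀ x ∈ V, ∀ y ∈ uIcc a b, (x, y) ∈ W ∧ ‖f x y‖ ≤ M := by
  have hcomp : IsCompact (({x₀} : Set E) ×ˢ uIcc a b) := isCompact_singleton.prod isCompact_uIcc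
  have hsub : ({x₀} : Set E) ×ˢ uIcc a b ⊆ W := by
    rintro ⟨x, y⟩ ⟨hx, hy⟩
    obtain rfl : x = x₀ := hx
    exact hx₀ y hy
  obtain ⟨M, hM⟩ := hcomp.exists_bound_of_continuousOn (hf.mono hsub)
  have hopen : IsOpen (W ∩ (fun p : E × ℝ => f p.1 p.2) ⁻¹' Metric.ball 0 (M + 1)) :=
    hf.isOpen_inter_preimage hW Metric.isOpen_ball
  obtain ⟨V, V', hV, -, hxV, hyV, hVV⟩ := generalized_tube_lemma (isCompact_singleton (x := x₀))
    (isCompact_uIcc (a := a) (b := b)) hopen (fun p hp => ⟨hsub hp, by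
      have := hM p hp
      simp only [mem_preimage, mem_ball_zero_iff]
      linarith⟩)
  refine ⟨V, hV.mem_nhds (hxV rfl), M + 1, fun x hx y hy => ?_⟩
  have := hVV (mk_mem_prod hx (hyV hy))
  exact ⟨this.1, by simpa using (mem_ball_zero_iff.1 this.2).le⟩

theorem continuousOn_slice {E F : Type*} [TopologicalSpace E] [TopologicalSpace F]
    {f : E → ℝ → F} {W : Set (E × ℝ)}
    (hf : ContinuousOn (fun p : E × ℝ => f p.1 p.2) W) {s : Set ℝ} {x : E}
    (hx : ∀ y ∈ s, (x, y) ∈ W) : ContinuousOn (f x) s :=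
  hf.comp (f := fun y : ℝ => (x, y)) (by fun_prop) hx

theorem continuousOn_intervalIntegral_param {E F : Type*} [NormedAddCommGroup E]
    [NormedAddCommGroup F] [NormedSpace ℝ F] {f : E → ℝ → F} {W : Set (E × ℝ)} (hW : IsOpen W)
    (hf : ContinuousOn (fun p : E × ℝ => f p.1 p.2) W) {a b : ℝ} {U : Set E}
    (hU : ∀ x ∈ U, ∀ y ∈ uIcc a b, (x, y) ∈ W) :
    ContinuousOn (fun x => ∫ y in a..b, f x y) U := by
  intro x₀ hx₀
  obtain ⟨V, hV, M, hM⟩ := exists_nhds_bound_of_continuousOn hW hf (hU x₀ hx₀)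
  refine (intervalIntegral.continuousAt_of_dominated_interval (bound := fun _ => M)
    ?_ ?_ ?_ ?_).continuousWithinAt
  · filter_upwards [hV] with x hx
    exact ((continuousOn_slice hf fun y hy => (hM x hx y hy).1).mono
      uIoc_subset_uIcc).aestronglyMeasurable measurableSet_uIoc
  · filter_upwards [hV] with x hx
    exact .of_forall fun y hy => (hM x hx y (uIoc_subset_uIcc hy)).2
  · exact intervalIntegrable_const
  · refine .of_forall fun y hy => ?_
    have := hf.continuousAt (hW.mem_nhds (hU x₀ hx₀ y (uIoc_subset_uIcc hy)))
    exact this.comp (f := fun x : E => (x, y)) (by fun_prop)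

theorem hasFDerivAt_slice {E F : Type*} [NormedAddCommGroup E] [NormedSpace ℝ E]
    [NormedAddCommGroup F] [NormedSpace ℝ F] {f : E → ℝ → F} {W : Set (E × ℝ)} (hW : IsOpen W)
    (hf : ContDiffOn ℝ 1 (fun p : E × ℝ => f p.1 p.2) W) {x : E} {y : ℝ} (h : (x, y) ∈ W) :
    HasFDerivAt (fun x => f x y) ((fderiv ℝ (fun p : E × ℝ => f p.1 p.2) (x, y)).comp
      (ContinuousLinearMap.inl ℝ E ℝ)) x := by
  have h1 : HasFDerivAt (fun p : E × ℝ => f p.1 p.2)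
      (fderiv ℝ (fun p : E × ℝ => f p.1 p.2) (x, y)) (x, y) :=
    ((hf.contDiffAt (hW.mem_nhds h)).differentiableAt (by simp)).hasFDerivAt
  exact HasFDerivAt.comp (f := fun e : E => (e, y)) x h1 (hasFDerivAt_prodMk_left x y)

/-- Compactness of the interval bounds the partial derivative uniformly near `x₀`, and this constant
is the dominating function. -/
theorem hasFDerivAt_intervalIntegral_param {E F : Type*} [NormedAddCommGroup E]
    [NormedSpace ℝ E] [NormedAddCommGroup F] [NormedSpace ℝ F] {f : E → ℝ → F}
    {W : Set (E × ℝ)} (hW : IsOpen W)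
    (hf : ContDiffOn ℝ 1 (fun p : E × ℝ => f p.1 p.2) W) {a b : ℝ} {x₀ : E}
    (hx₀ : ∀ y ∈ uIcc a b, (x₀, y) ∈ W) :
    HasFDerivAt (fun x => ∫ y in a..b, f x y)
      (∫ y in a..b, (fderiv ℝ (fun p : E × ℝ => f p.1 p.2) (x₀, y)).comp
        (ContinuousLinearMap.inl ℝ E ℝ)) x₀ := by
  have hf' : ContinuousOn (fun p : E × ℝ => (fderiv ℝ (fun p : E × ℝ => f p.1 p.2) (p.1, p.2)).comp
      (ContinuousLinearMap.inl ℝ E ℝ)) W :=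
    (hf.continuousOn_fderiv_of_isOpen hW le_rfl).clm_comp continuousOn_const
  obtain ⟨V, hV, M, hM⟩ := exists_nhds_bound_of_continuousOn
    (f := fun x y => (fderiv ℝ (fun p : E × ℝ => f p.1 p.2) (x, y)).comp
      (ContinuousLinearMap.inl ℝ E ℝ)) hW hf' hx₀
  refine intervalIntegral.hasFDerivAt_integral_of_dominated_of_fderiv_le (bound := fun _ => M)
    (F' := fun x y => (fderiv ℝ (fun p : E × ℝ => f p.1 p.2) (x, y)).comp
      (ContinuousLinearMap.inl ℝ E ℝ)) hV ?_ ?_ ?_ ?_ ?_ ?_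
  · filter_upwards [hV] with x hx
    exact ((continuousOn_slice hf.continuousOn fun y hy => (hM x hx y hy).1).mono
      uIoc_subset_uIcc).aestronglyMeasurable measurableSet_uIoc
  · exact (continuousOn_slice hf.continuousOn hx₀).intervalIntegrable
  · exact ((continuousOn_slice (f := fun x y => (fderiv ℝ (fun p : E × ℝ => f p.1 p.2) (x, y)).comp
      (ContinuousLinearMap.inl ℝ E ℝ)) hf' hx₀).mono
      uIoc_subset_uIcc).aestronglyMeasurable measurableSet_uIoc
  · exact .of_forall fun y hy x hx => (hM x hx y (uIoc_subset_uIcc hy)).2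
  · exact intervalIntegrable_const
  · exact .of_forall fun y hy x hx => hasFDerivAt_slice hW hf (hM x hx y (uIoc_subset_uIcc hy)).1

/-- Integrals over a compact interval of a `C^n` function are `C^n` in the parameter. -/
theorem contDiffOn_intervalIntegral_nat {E : Type v} [NormedAddCommGroup E]
    [NormedSpace ℝ E] {a b : ℝ} {U : Set E} (hUo : IsOpen U) {W : Set (E × ℝ)} (hW : IsOpen W)
    (hU : ∀ x ∈ U, ∀ y ∈ uIcc a b, (x, y) ∈ W) (n : ℕ) :
    ∀ {F : Type v} [NormedAddCommGroup F] [NormedSpace ℝ F] {f : E → ℝ → F},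
    ContDiffOn ℝ n (fun p : E × ℝ => f p.1 p.2) W →
    ContDiffOn ℝ n (fun x => ∫ y in a..b, f x y) U := by
  -- The step passes from `F` to the space of continuous linear maps `E →L[ℝ] F`, so `F` has to vary
  -- in the induction, and `E` and `F` share a universe.
  induction n with
  | zero =>
    intro F _ _ f hf
    simp only [Nat.cast_zero, contDiffOn_zero] at hf ⊢
    exact continuousOn_intervalIntegral_param hW hf hU
  | succ n ih =>
    intro F _ _ f hf
    have hf1 : ContDiffOn ℝ 1 (fun p : E × ℝ => f p.1 p.2) W := hf.of_le (by norm_cast; omega)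
    have hd := fun x (hx : x ∈ U) => hasFDerivAt_intervalIntegral_param hW hf1 (hU x hx)
    have key : ContDiffOn ℝ n (fun x => ∫ y in a..b,
        (fderiv ℝ (fun p : E × ℝ => f p.1 p.2) (x, y)).comp
        (ContinuousLinearMap.inl ℝ E ℝ)) U := by
      refine ih ?_
      exact (hf.fderiv_of_isOpen hW (by norm_cast)).clm_comp contDiffOn_const
    push_cast
    rw [contDiffOn_succ_iff_fderiv_of_isOpen hUo]
    refine ⟨fun x hx => (hd x hx).differentiableAt.differentiableWithinAt, by simp, ?_⟩
    exact key.congr fun x hx => (hd x hx).fderiv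

theorem contDiffOn_intervalIntegral {E F : Type v} [NormedAddCommGroup E]
    [NormedSpace ℝ E] [NormedAddCommGroup F] [NormedSpace ℝ F] {f : E → ℝ → F}
    {a b : ℝ} {U : Set E} (hUo : IsOpen U) {W : Set (E × ℝ)} (hW : IsOpen W)
    (hU : ∀ x ∈ U, ∀ y ∈ uIcc a b, (x, y) ∈ W) {n : ℕ∞}
    (hf : ContDiffOn ℝ n (fun p : E × ℝ => f p.1 p.2) W) :
    ContDiffOn ℝ n (fun x => ∫ y in a..b, f x y) U := by
  rw [contDiffOn_iff_forall_nat_le]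
  exact fun m hm => contDiffOn_intervalIntegral_nat hUo hW hU m (hf.of_le (by exact_mod_cast hm))

/-- Differentiation under the integral sign. -/
theorem hasDerivAt_intervalIntegral_param {f : ℝ → ℝ → ℝ}
    {W : Set (ℝ × ℝ)} (hW : IsOpen W)
    (hf : ContDiffOn ℝ 1 (fun p : ℝ × ℝ => f p.1 p.2) W) {a b : ℝ} {x₀ : ℝ}
    (hx₀ : ∀ y ∈ uIcc a b, (x₀, y) ∈ W) :
    HasDerivAt (fun x => ∫ y in a..b, f x y)
      (∫ y in a..b, deriv (fun x => f x y) x₀) x₀ := by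
  have h := (hasFDerivAt_intervalIntegral_param hW hf hx₀).hasDerivAt
  rwa [ContinuousLinearMap.intervalIntegral_apply, intervalIntegral.integral_congr
    (g := fun y => deriv (fun x => f x y) x₀)] at h
  · exact fun y hy => (hasFDerivAt_slice hW hf (hx₀ y hy)).hasDerivAt.deriv.symm
  · refine (continuousOn_slice (f := fun x y => (fderiv ℝ (fun p : ℝ × ℝ => f p.1 p.2) (x, y)).comp
      (ContinuousLinearMap.inl ℝ ℝ ℝ)) (W := W) ?_ hx₀).intervalIntegrable
    exact (hf.continuousOn_fderiv_of_isOpen hW le_rfl).clm_comp continuousOn_const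

/-! ### Partial derivatives and smooth functions on a strip -/

theorem hasDerivAt_fst_of_differentiableAt {f : ℝ → ℝ → ℝ} {t x : ℝ}
    (hf : DifferentiableAt ℝ (fun p : ℝ × ℝ => f p.1 p.2) (t, x)) :
    HasDerivAt (fun s => f s x) (fderiv ℝ (fun p : ℝ × ℝ => f p.1 p.2) (t, x) (1, 0)) t :=
  hf.hasFDerivAt.comp_hasDerivAt (f := fun s => (s, x)) t
    ((hasDerivAt_id t).prodMk (hasDerivAt_const t x))

theorem hasDerivAt_snd_of_differentiableAt {f : ℝ → ℝ → ℝ} {t x : ℝ}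
    (hf : DifferentiableAt ℝ (fun p : ℝ × ℝ => f p.1 p.2) (t, x)) :
    HasDerivAt (fun y => f t y) (fderiv ℝ (fun p : ℝ × ℝ => f p.1 p.2) (t, x) (0, 1)) x :=
  hf.hasFDerivAt.comp_hasDerivAt (f := fun y => (t, y)) x
    ((hasDerivAt_const x t).prodMk (hasDerivAt_id x))

/-- Both sides are the second Fréchet derivative on the two unit vectors, in opposite orders. -/
theorem deriv_deriv_comm {f : ℝ → ℝ → ℝ} {t x : ℝ}
    (hf : ContDiffAt ℝ ∞ (fun p : ℝ × ℝ => f p.1 p.2) (t, x)) :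
    deriv (fun s => deriv (fun y => f s y) x) t = deriv (fun y => deriv (fun s => f s y) t) x := by
  have hev : ∀ᶠ p in 𝓝 (t, x), DifferentiableAt ℝ (fun p : ℝ × ℝ => f p.1 p.2) p := by
    filter_upwards [(hf.of_le (m := 1) (by norm_cast)).eventually (by simp)] with p hp
    exact hp.differentiableAt (by simp)
  have hd : DifferentiableAt ℝ (fderiv ℝ (fun p : ℝ × ℝ => f p.1 p.2)) (t, x) :=
    (hf.fderiv_right (m := 1) (by norm_cast)).differentiableAt (by simp)
  have hv : ∀ v : ℝ × ℝ, HasFDerivAt (fun p => fderiv ℝ (fun p : ℝ × ℝ => f p.1 p.2) p v)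
      ((fderiv ℝ (fderiv ℝ (fun p : ℝ × ℝ => f p.1 p.2)) (t, x)).flip v) (t, x) :=
    fun v => by
      simpa using hd.hasFDerivAt.clm_apply (hasFDerivAt_const v (t, x))
  have e1 : (fun s => deriv (fun y => f s y) x) =ᶠ[𝓝 t]
      fun s => fderiv ℝ (fun p : ℝ × ℝ => f p.1 p.2) (s, x) (0, 1) := by
    filter_upwards [(Continuous.prodMk_left x).continuousAt.eventually hev] with s hs
    exact (hasDerivAt_snd_of_differentiableAt hs).deriv
  have e2 : (fun y => deriv (fun s => f s y) t) =ᶠ[𝓝 x]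
      fun y => fderiv ℝ (fun p : ℝ × ℝ => f p.1 p.2) (t, y) (1, 0) := by
    filter_upwards [(Continuous.prodMk_right t).continuousAt.eventually hev] with y hy
    exact (hasDerivAt_fst_of_differentiableAt hy).deriv
  rw [e1.deriv_eq, e2.deriv_eq]
  have h1 := hasDerivAt_fst_of_differentiableAt
    (f := fun s y => fderiv ℝ (fun p : ℝ × ℝ => f p.1 p.2) (s, y) (0, 1))
    (hv (0, 1)).differentiableAt
  have h2 := hasDerivAt_snd_of_differentiableAt
    (f := fun s y => fderiv ℝ (fun p : ℝ × ℝ => f p.1 p.2) (s, y) (1, 0))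
    (hv (1, 0)).differentiableAt
  rw [h1.deriv, h2.deriv, (hv (0, 1)).fderiv, (hv (1, 0)).fderiv]
  exact (hf.isSymmSndFDerivAt (by simp; norm_cast)) (1, 0) (0, 1)

/-- The time derivative of a function of time and space. -/
noncomputable def partialTime (f : ℝ → ℝ → ℝ) (t x : ℝ) : ℝ := deriv (fun s => f s x) t

/-- The space derivative of a function of time and space. -/
noncomputable def partialSpace (f : ℝ → ℝ → ℝ) (t x : ℝ) : ℝ := deriv (f t) x

/-- Smoothness on the strip `J × ℝ`. -/
def SmoothOnStrip (J : Set ℝ) (f : ℝ → ℝ → ℝ) : Prop :=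
  ContDiffOn ℝ ∞ (fun p : ℝ × ℝ => f p.1 p.2) (J ×ˢ univ)

namespace SmoothOnStrip

variable {J : Set ℝ} {f g : ℝ → ℝ → ℝ}

theorem contDiffAt (hJ : IsOpen J) (hf : SmoothOnStrip J f) {t : ℝ} (ht : t ∈ J) (x : ℝ) :
    ContDiffAt ℝ ∞ (fun p : ℝ × ℝ => f p.1 p.2) (t, x) :=
  ContDiffOn.contDiffAt hf ((hJ.prod isOpen_univ).mem_nhds ⟨ht, mem_univ x⟩)

theorem differentiableAt (hJ : IsOpen J) (hf : SmoothOnStrip J f) {t : ℝ} (ht : t ∈ J) (x : ℝ) :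
    DifferentiableAt ℝ (fun p : ℝ × ℝ => f p.1 p.2) (t, x) :=
  (hf.contDiffAt hJ ht x).differentiableAt (by simp)

theorem hasDerivAt_time (hJ : IsOpen J) (hf : SmoothOnStrip J f) {t : ℝ} (ht : t ∈ J) (x : ℝ) :
    HasDerivAt (fun s => f s x) (partialTime f t x) t :=
  (hasDerivAt_fst_of_differentiableAt (hf.differentiableAt hJ ht x)).differentiableAt.hasDerivAt

theorem hasDerivAt_space (hJ : IsOpen J) (hf : SmoothOnStrip J f) {t : ℝ} (ht : t ∈ J) (x : ℝ) :
    HasDerivAt (f t) (partialSpace f t x) x :=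
  (hasDerivAt_snd_of_differentiableAt (hf.differentiableAt hJ ht x)).differentiableAt.hasDerivAt

theorem contDiffOn_fderiv (hJ : IsOpen J) (hf : SmoothOnStrip J f) :
    ContDiffOn ℝ ∞ (fderiv ℝ (fun p : ℝ × ℝ => f p.1 p.2)) (J ×ˢ univ) :=
  ContDiffOn.fderiv_of_isOpen hf (hJ.prod isOpen_univ) (by simp)

protected theorem partialTime (hJ : IsOpen J) (hf : SmoothOnStrip J f) :
    SmoothOnStrip J (partialTime f) :=
  ((hf.contDiffOn_fderiv hJ).clm_apply (contDiffOn_const (c := ((1, 0) : ℝ × ℝ)))).congr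
    fun p hp => (hasDerivAt_fst_of_differentiableAt (hf.differentiableAt hJ hp.1 p.2)).deriv

protected theorem partialSpace (hJ : IsOpen J) (hf : SmoothOnStrip J f) :
    SmoothOnStrip J (partialSpace f) :=
  ((hf.contDiffOn_fderiv hJ).clm_apply (contDiffOn_const (c := ((0, 1) : ℝ × ℝ)))).congr
    fun p hp => (hasDerivAt_snd_of_differentiableAt (hf.differentiableAt hJ hp.1 p.2)).deriv

theorem partial_comm (hJ : IsOpen J) (hf : SmoothOnStrip J f) {t : ℝ} (ht : t ∈ J) (x : ℝ) :
    partialTime (partialSpace f) t x = partialSpace (partialTime f) t x :=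
  deriv_deriv_comm (hf.contDiffAt hJ ht x)

theorem congr (hf : SmoothOnStrip J f) (h : ∀ t ∈ J, ∀ x, g t x = f t x) : SmoothOnStrip J g :=
  ContDiffOn.congr hf fun p hp => h p.1 hp.1 p.2

theorem add (hf : SmoothOnStrip J f) (hg : SmoothOnStrip J g) :
    SmoothOnStrip J fun t x => f t x + g t x := ContDiffOn.add hf hg

theorem sub (hf : SmoothOnStrip J f) (hg : SmoothOnStrip J g) :
    SmoothOnStrip J fun t x => f t x - g t x := ContDiffOn.sub hf hg

theorem mul (hf : SmoothOnStrip J f) (hg : SmoothOnStrip J g) :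
    SmoothOnStrip J fun t x => f t x * g t x := ContDiffOn.mul hf hg

theorem div (hf : SmoothOnStrip J f) (hg : SmoothOnStrip J g) (h : ∀ t ∈ J, ∀ x, g t x ≠ 0) :
    SmoothOnStrip J fun t x => f t x / g t x := ContDiffOn.div hf hg fun p hp => h p.1 hp.1 p.2

theorem pow (hf : SmoothOnStrip J f) (n : ℕ) :
    SmoothOnStrip J fun t x => f t x ^ n := ContDiffOn.pow hf n

theorem const_mul (c : ℝ) (hf : SmoothOnStrip J f) :
    SmoothOnStrip J fun t x => c * f t x := ContDiffOn.mul contDiffOn_const hf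

theorem of_time {h : ℝ → ℝ} (hh : ContDiffOn ℝ ∞ h J) : SmoothOnStrip J fun t _ => h t :=
  ContDiffOn.comp (f := fun p : ℝ × ℝ => p.1) hh contDiffOn_fst fun _ hp => hp.1

theorem of_space {h : ℝ → ℝ} (hh : ContDiff ℝ ∞ h) : SmoothOnStrip J fun _ x => h x :=
  (hh.comp contDiff_snd).contDiffOn

theorem comp (hf : SmoothOnStrip J f) (hg : SmoothOnStrip J g) :
    SmoothOnStrip J fun t x => f t (g t x) :=
  ContDiffOn.comp (g := fun p : ℝ × ℝ => f p.1 p.2) (f := fun p : ℝ × ℝ => (p.1, g p.1 p.2)) hf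
    (contDiffOn_fst.prodMk hg) fun _ hp => ⟨hp.1, mem_univ _⟩

theorem time_slice (hf : SmoothOnStrip J f) (x : ℝ) : ContDiffOn ℝ ∞ (fun t => f t x) J :=
  ContDiffOn.comp (g := fun p : ℝ × ℝ => f p.1 p.2) (f := fun t => (t, x)) hf
    (contDiffOn_id.prodMk contDiffOn_const) fun _ ht => ⟨ht, mem_univ _⟩

theorem space_slice (hf : SmoothOnStrip J f) {t : ℝ} (ht : t ∈ J) : ContDiff ℝ ∞ (f t) :=
  contDiffOn_univ.1 <| ContDiffOn.comp (g := fun p : ℝ × ℝ => f p.1 p.2) (f := fun x => (t, x)) hf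
    (contDiffOn_const.prodMk contDiffOn_id) fun _ _ => ⟨ht, mem_univ _⟩

theorem continuous_slice (hf : SmoothOnStrip J f) {t : ℝ} (ht : t ∈ J) : Continuous (f t) :=
  (hf.space_slice ht).continuous

theorem intervalIntegrable (hf : SmoothOnStrip J f) {t : ℝ} (ht : t ∈ J) (a b : ℝ) :
    IntervalIntegrable (f t) volume a b :=
  (hf.continuous_slice ht).intervalIntegrable a b

theorem hasDerivAt_comp_time (hJ : IsOpen J) (hf : SmoothOnStrip J f) {t : ℝ} (ht : t ∈ J)
    {h : ℝ → ℝ} {h' : ℝ} (hh : HasDerivAt h h' t) :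
    HasDerivAt (fun s => f s (h s)) (partialTime f t (h t) + partialSpace f t (h t) * h') t := by
  have hd := hf.differentiableAt hJ ht (h t)
  have := hd.hasFDerivAt.comp_hasDerivAt (f := fun s => (s, h s)) t ((hasDerivAt_id t).prodMk hh)
  refine this.congr_deriv ?_
  unfold partialTime partialSpace
  rw [(hasDerivAt_fst_of_differentiableAt hd).deriv,
    (hasDerivAt_snd_of_differentiableAt hd).deriv, mul_comm, ← smul_eq_mul, ← map_smul, ← map_add]
  simp

theorem partialTime_comp (hJ : IsOpen J) (hf : SmoothOnStrip J f) (hg : SmoothOnStrip J g)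
    {t : ℝ} (ht : t ∈ J) (x : ℝ) :
    partialTime (fun t x => f t (g t x)) t x =
      partialTime f t (g t x) + partialSpace f t (g t x) * partialTime g t x :=
  (hf.hasDerivAt_comp_time hJ ht (hg.hasDerivAt_time hJ ht x)).deriv

theorem partialSpace_comp (hJ : IsOpen J) (hf : SmoothOnStrip J f) (hg : SmoothOnStrip J g)
    {t : ℝ} (ht : t ∈ J) (x : ℝ) :
    partialSpace (fun t x => f t (g t x)) t x =
      partialSpace f t (g t x) * partialSpace g t x :=
  ((hf.hasDerivAt_space hJ ht (g t x)).comp x (hg.hasDerivAt_space hJ ht x)).deriv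

protected theorem integral (hJ : IsOpen J) (hf : SmoothOnStrip J f) (a b : ℝ) :
    ContDiffOn ℝ ∞ (fun t => ∫ x in a..b, f t x) J :=
  contDiffOn_intervalIntegral (n := ⊤) hJ (hJ.prod isOpen_univ) (fun _ ht _ _ => ⟨ht, mem_univ _⟩) hf

theorem hasDerivAt_integral (hJ : IsOpen J) (hf : SmoothOnStrip J f) (a b : ℝ) {t : ℝ}
    (ht : t ∈ J) :
    HasDerivAt (fun t => ∫ x in a..b, f t x) (∫ x in a..b, partialTime f t x) t :=
  hasDerivAt_intervalIntegral_param (hJ.prod isOpen_univ)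
    (ContDiffOn.of_le hf (by norm_cast)) fun _ _ => ⟨ht, mem_univ _⟩

end SmoothOnStrip

/-! ### Primitives in time and in space -/

/-- Substitution: a primitive in terms of an integral over `[0, 1]`. -/
theorem intervalIntegral_eq_mul_integral_unit (h : ℝ → ℝ) (a b : ℝ) :
    ∫ s in a..b, h s = (b - a) * ∫ r in (0 : ℝ)..1, h (a + r * (b - a)) := by
  have := intervalIntegral.mul_integral_comp_add_mul (f := h) (a := 0) (b := 1) (b - a) a
  simp only [mul_zero, add_zero, mul_one, add_sub_cancel] at this
  rw [← this]
  simp only [mul_comm]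

theorem mem_of_ordConnected_segment {J : Set ℝ} (hJ' : J.OrdConnected) {a b r : ℝ} (ha : a ∈ J)
    (hb : b ∈ J) (hr : r ∈ uIcc (0 : ℝ) 1) : a + r * (b - a) ∈ J := by
  rw [uIcc_of_le zero_le_one] at hr
  have := hJ'.convex.add_smul_sub_mem ha hb hr
  simpa using this

/-- The primitive in time of a `C^n` function of time and a parameter is `C^n`. -/
theorem contDiffOn_primitive_time {J : Set ℝ} (hJ : IsOpen J) (hJ' : J.OrdConnected) {t₀ : ℝ}
    (ht₀ : t₀ ∈ J) {f : ℝ → ℝ → ℝ} {n : ℕ∞}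
    (hf : ContDiffOn ℝ n (fun p : ℝ × ℝ => f p.1 p.2) (J ×ˢ univ)) :
    ContDiffOn ℝ n (fun p : ℝ × ℝ => ∫ s in t₀..p.1, f s p.2) (J ×ˢ univ) := by
  -- Rescaling to `[0, 1]` moves the variable end point into the integrand, where it is a parameter.
  refine ContDiffOn.congr (((contDiff_fst.sub contDiff_const).contDiffOn).mul ?_)
    fun p _ => intervalIntegral_eq_mul_integral_unit (fun s => f s p.2) t₀ p.1
  have hc : ContDiff ℝ n (fun q : (ℝ × ℝ) × ℝ => (t₀ + q.2 * (q.1.1 - t₀), q.1.2)) := by fun_prop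
  refine contDiffOn_intervalIntegral (hJ.prod isOpen_univ)
    (W := (fun q : (ℝ × ℝ) × ℝ => (t₀ + q.2 * (q.1.1 - t₀), q.1.2)) ⁻¹' (J ×ˢ univ))
    ((hJ.prod isOpen_univ).preimage hc.continuous) ?_
    (f := fun p r => f (t₀ + r * (p.1 - t₀)) p.2) (hf.comp hc.contDiffOn fun q hq => hq)
  exact fun p hp r hr => ⟨mem_of_ordConnected_segment hJ' ht₀ hp.1 hr, mem_univ _⟩

namespace SmoothOnStrip

variable {J : Set ℝ} {f g : ℝ → ℝ → ℝ}

theorem primitive_time (hJ : IsOpen J) (hJ' : J.OrdConnected) {t₀ : ℝ}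
    (ht₀ : t₀ ∈ J) (hf : SmoothOnStrip J f) : SmoothOnStrip J fun t x => ∫ s in t₀..t, f s x :=
  contDiffOn_primitive_time (n := ⊤) hJ hJ' ht₀ hf

theorem primitive_space (hJ : IsOpen J) (hf : SmoothOnStrip J f) :
    SmoothOnStrip J fun t x => ∫ y in (0 : ℝ)..x, f t y := by
  have hc : ContDiff ℝ ∞ (fun q : (ℝ × ℝ) × ℝ => (q.1.1, 0 + q.2 * (q.1.2 - 0))) := by fun_prop
  unfold SmoothOnStrip
  refine ContDiffOn.congr (((contDiff_snd.sub contDiff_const).contDiffOn).mul ?_)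
    fun p _ => intervalIntegral_eq_mul_integral_unit (f p.1) 0 p.2
  refine contDiffOn_intervalIntegral (n := ⊤) (hJ.prod isOpen_univ)
    (W := (fun q : (ℝ × ℝ) × ℝ => (q.1.1, 0 + q.2 * (q.1.2 - 0))) ⁻¹' (J ×ˢ univ))
    ((hJ.prod isOpen_univ).preimage hc.continuous) ?_
    (f := fun p r => f p.1 (0 + r * (p.2 - 0))) (ContDiffOn.comp hf hc.contDiffOn fun q hq => hq)
  exact fun p hp r hr => ⟨hp.1, mem_univ _⟩

end SmoothOnStrip

/-! ### Periodic functions and curves of circle diffeomorphisms -/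

theorem Function.Periodic.exists_mem_Icc_eq {f : ℝ → ℝ} (hf : Function.Periodic f 1) (x : ℝ) :
    ∃ y ∈ Icc (0 : ℝ) 1, f x = f y := by
  refine ⟨x - ⌊x⌋, ⟨Int.fract_nonneg x, (Int.fract_lt_one x).le⟩, ?_⟩
  simpa only [mul_one] using (hf.sub_int_mul_eq ⌊x⌋).symm

/-- A function on the strip which is periodic in space is bounded on compact time intervals. -/
theorem SmoothOnStrip.exists_bound {J : Set ℝ} {f : ℝ → ℝ → ℝ} (hf : SmoothOnStrip J f)
    (hp : ∀ t ∈ J, Function.Periodic (f t) 1) {a b : ℝ} (hab : Icc a b ⊆ J) :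
    ∃ M : ℝ, 0 ≤ M ∧ ∀ t ∈ Icc a b, ∀ x, |f t x| ≤ M := by
  obtain ⟨M, hM⟩ := (isCompact_Icc.prod isCompact_Icc).exists_bound_of_continuousOn
    ((ContDiffOn.continuousOn hf).mono
      (prod_mono hab (subset_univ (Icc (0 : ℝ) 1))))
  refine ⟨max M 0, le_max_right _ _, fun t ht x => ?_⟩
  obtain ⟨y, hy, hxy⟩ := (hp t (hab ht)).exists_mem_Icc_eq x
  rw [hxy]
  exact (hM (t, y) ⟨ht, hy⟩).trans (le_max_left _ _)

theorem Function.Periodic.deriv {f : ℝ → ℝ} {c : ℝ} (hf : Function.Periodic f c) :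
    Function.Periodic (deriv f) c := fun x => by
  rw [← deriv_comp_add_const]
  exact congrArg (fun g => _root_.deriv g x) (funext hf)

theorem periodic_partialSpace {J : Set ℝ} {f : ℝ → ℝ → ℝ}
    (hp : ∀ t ∈ J, Function.Periodic (f t) 1) :
    ∀ t ∈ J, Function.Periodic (partialSpace f t) 1 := fun t ht => (hp t ht).deriv

theorem partialTime_congr {J : Set ℝ} (hJ : IsOpen J) {f g : ℝ → ℝ → ℝ} {x y : ℝ}
    (h : ∀ t ∈ J, f t x = g t y) {t : ℝ} (ht : t ∈ J) :
    partialTime f t x = partialTime g t y :=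
  EventuallyEq.deriv_eq (by filter_upwards [hJ.mem_nhds ht] with s hs using h s hs)

theorem periodic_partialTime {J : Set ℝ} (hJ : IsOpen J) {f : ℝ → ℝ → ℝ}
    (hp : ∀ t ∈ J, Function.Periodic (f t) 1) :
    ∀ t ∈ J, Function.Periodic (partialTime f t) 1 :=
  fun _ ht x => partialTime_congr hJ (fun s hs => hp s hs x) ht

/-- A lift of degree one with positive derivative is a bijection of the line. -/
theorem surjective_of_add_one {g : ℝ → ℝ} (hg : Continuous g) (h1 : ∀ x, g (x + 1) = g x + 1) :
    Function.Surjective g := by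
  intro y
  -- At the integers `g` takes the values `g 0 + n`, so every `y` lies between two consecutive ones.
  have hint : ∀ n : ℤ, g n = g 0 + n := by
    have hper : Function.Periodic (fun x => g x - x) 1 := fun x => by simp [h1]
    intro n
    have := hper.int_mul n 0
    simp only [mul_one, zero_add] at this
    linarith
  have hfl := Int.floor_le (y - g 0)
  have hlt := Int.lt_floor_add_one (y - g 0)
  obtain ⟨x, -, hx⟩ := intermediate_value_Icc
    (show ((⌊y - g 0⌋ : ℤ) : ℝ) ≤ ((⌊y - g 0⌋ + 1 : ℤ) : ℝ) by push_cast; linarith)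
    hg.continuousOn (show y ∈ Icc _ _ by
      rw [hint, hint]; push_cast; constructor <;> linarith)
  exact ⟨x, hx⟩

/-- A smooth curve of diffeomorphisms of the circle has a smooth curve of inverses. -/
theorem SmoothOnStrip.exists_inverse {J : Set ℝ} (hJ : IsOpen J) {φ : ℝ → ℝ → ℝ}
    (hφ : SmoothOnStrip J φ) (h1 : ∀ t ∈ J, ∀ x, φ t (x + 1) = φ t x + 1)
    (hpos : ∀ t ∈ J, ∀ x, 0 < partialSpace φ t x) :
    ∃ ψ : ℝ → ℝ → ℝ, SmoothOnStrip J ψ ∧ ∀ t ∈ J, ∀ x, φ t (ψ t x) = x ∧ ψ t (φ t x) = x := by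
  have hinj : ∀ t ∈ J, Function.Injective (φ t) := fun t ht =>
    (strictMono_of_deriv_pos (hpos t ht)).injective
  have hsurj : ∀ t ∈ J, Function.Surjective (φ t) := fun t ht =>
    surjective_of_add_one (hφ.continuous_slice ht) (h1 t ht)
  refine ⟨fun t => Function.invFun (φ t), ?_, fun t ht x =>
    ⟨Function.rightInverse_invFun (hsurj t ht) x, Function.leftInverse_invFun (hinj t ht) x⟩⟩
  rintro ⟨t, y⟩ ⟨ht, -⟩
  refine ContDiffAt.contDiffWithinAt ?_
  obtain ⟨x, rfl⟩ := hsurj t ht y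
  have hd := hφ.differentiableAt hJ ht x
  -- The inverse function theorem is applied in the plane, with time kept as a coordinate, to get
  -- joint smoothness of the inverse.
  set Φ : ℝ × ℝ → ℝ × ℝ := fun p => (p.1, φ p.1 p.2) with hΦ
  have hΦd : ContDiffAt ℝ ∞ Φ (t, x) := contDiffAt_fst.prodMk (hφ.contDiffAt hJ ht x)
  set L := fderiv ℝ (fun p : ℝ × ℝ => φ p.1 p.2) (t, x)
  have hc : 0 < L (0, 1) := by
    rw [← (hasDerivAt_snd_of_differentiableAt hd).deriv]
    exact hpos t ht x
  have hL : ∀ p : ℝ × ℝ, L p = p.1 * L (1, 0) + p.2 * L (0, 1) := fun p => by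
    rw [← smul_eq_mul, ← smul_eq_mul, ← map_smul, ← map_smul, ← map_add]
    simp
  let e : (ℝ × ℝ) ≃L[ℝ] (ℝ × ℝ) := ContinuousLinearEquiv.equivOfInverse
    ((ContinuousLinearMap.fst ℝ ℝ ℝ).prod L)
    ((ContinuousLinearMap.fst ℝ ℝ ℝ).prod ((L (0, 1))⁻¹ •
      (ContinuousLinearMap.snd ℝ ℝ ℝ - (L (1, 0)) • ContinuousLinearMap.fst ℝ ℝ ℝ)))
    (fun p => by
      ext
      · simp
      · simp only [ContinuousLinearMap.prod_apply, ContinuousLinearMap.coe_fst',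
          FunLike.coe_smul, FunLike.coe_sub, Pi.smul_apply, Pi.sub_apply,
          ContinuousLinearMap.coe_snd', smul_eq_mul, hL p]
        field_simp
        ring)
    (fun p => by
      ext
      · simp
      · simp only [ContinuousLinearMap.prod_apply, ContinuousLinearMap.coe_fst',
          FunLike.coe_smul, FunLike.coe_sub, Pi.smul_apply, Pi.sub_apply,
          ContinuousLinearMap.coe_snd', smul_eq_mul]
        rw [hL]
        field_simp
        ring)
  have he : HasFDerivAt Φ (e : (ℝ × ℝ) →L[ℝ] (ℝ × ℝ)) (t, x) := by
    exact hasFDerivAt_fst.prodMk hd.hasFDerivAt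
  have hloc := hΦd.to_localInverse he (by simp)
  have hstr := hΦd.hasStrictFDerivAt' he (by simp)
  refine ContDiffAt.congr_of_eventuallyEq (f := fun p => (hΦd.localInverse he (by simp) p).2)
    hloc.snd ?_
  -- Near `Φ (t, x)` the local inverse stays over `J`, where injectivity of each `φ s` identifies it
  -- with the fibrewise inverse.
  have htend : Tendsto (hΦd.localInverse he (by simp)) (𝓝 (Φ (t, x))) (𝓝 (t, x)) :=
    hstr.localInverse_tendsto
  filter_upwards [htend.eventually ((hJ.prod isOpen_univ).mem_nhds ⟨ht, mem_univ x⟩),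
    hstr.eventually_right_inverse] with p hp hp'
  have hp'' : Φ (hΦd.localInverse he (by simp) p) = p := hp'
  have h1 : (hΦd.localInverse he (by simp) p).1 = p.1 := by
    simpa only [hΦ] using congrArg Prod.fst hp''
  have h2 : φ (hΦd.localInverse he (by simp) p).1 (hΦd.localInverse he (by simp) p).2 = p.2 := by
    simpa only [hΦ] using congrArg Prod.snd hp''
  rw [h1] at h2
  rw [← h2]
  exact Function.leftInverse_invFun (hinj p.1 (h1 ▸ hp.1)) _

/-! ### Flows of time-dependent vector fields on the circle -/

/-- The slope of the secant of `u t` between `x` and `y`. -/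
noncomputable def secantSlope (u : ℝ → ℝ → ℝ) (t x y : ℝ) : ℝ :=
  ∫ r in (0 : ℝ)..1, partialSpace u t (x + r * (y - x))

theorem secantSlope_self (u : ℝ → ℝ → ℝ) (t x : ℝ) : secantSlope u t x x = partialSpace u t x := by
  simp [secantSlope]

/-- The fundamental theorem of calculus on the segment. Unlike the difference quotient, this slope
is continuous across the diagonal. -/
theorem sub_eq_mul_secantSlope {J : Set ℝ} (hJ : IsOpen J) {u : ℝ → ℝ → ℝ}
    (hu : SmoothOnStrip J u) {t : ℝ} (ht : t ∈ J) (x y : ℝ) :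
    u t y - u t x = (y - x) * secantSlope u t x y := by
  rw [secantSlope, ← intervalIntegral_eq_mul_integral_unit]
  exact (intervalIntegral.integral_eq_sub_of_hasDerivAt
    (fun z _ => hu.hasDerivAt_space hJ ht z) ((hu.partialSpace hJ).intervalIntegrable ht x y)).symm

theorem continuousOn_secantSlope {J : Set ℝ} (hJ : IsOpen J) {u : ℝ → ℝ → ℝ}
    (hu : SmoothOnStrip J u) :
    ContinuousOn (fun p : ℝ × ℝ × ℝ => secantSlope u p.1 p.2.1 p.2.2) (J ×ˢ univ) := by
  have hc : Continuous (fun q : (ℝ × ℝ × ℝ) × ℝ =>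
    (q.1.1, q.1.2.1 + q.2 * (q.1.2.2 - q.1.2.1))) := by fun_prop
  exact continuousOn_intervalIntegral_param
    (W := (fun q : (ℝ × ℝ × ℝ) × ℝ => (q.1.1, q.1.2.1 + q.2 * (q.1.2.2 - q.1.2.1))) ⁻¹' (J ×ˢ univ))
    ((hJ.prod isOpen_univ).preimage hc)
    (f := fun p r => partialSpace u p.1 (p.2.1 + r * (p.2.2 - p.2.1)))
    (ContinuousOn.comp (ContDiffOn.continuousOn (hu.partialSpace hJ)) hc.continuousOn
      fun q hq => hq) fun p hp r _ => ⟨hp.1, mem_univ _⟩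

theorem abs_secantSlope_le {u : ℝ → ℝ → ℝ} {t K : ℝ} (hK : ∀ x, |partialSpace u t x| ≤ K)
    (x y : ℝ) : |secantSlope u t x y| ≤ K := by
  simpa [secantSlope] using intervalIntegral.norm_integral_le_of_norm_le_const (a := 0) (b := 1)
    (f := fun r => partialSpace u t (x + r * (y - x))) (fun r _ => hK _)

theorem hasDerivAt_primitive {J : Set ℝ} (hJ : IsOpen J) (hJ' : J.OrdConnected) {a : ℝ → ℝ}
    (ha : ContinuousOn a J) {s t : ℝ} (hs : s ∈ J) (ht : t ∈ J) :
    HasDerivAt (fun t => ∫ r in s..t, a r) (a t) t :=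
  intervalIntegral.integral_hasDerivAt_right
    (ha.mono (hJ'.uIcc_subset hs ht)).intervalIntegrable
    (ha.stronglyMeasurableAtFilter hJ t ht) (ha.continuousAt (hJ.mem_nhds ht))

theorem eq_of_hasDerivAt_zero {J : Set ℝ} (hJ : IsOpen J) (hJ' : J.OrdConnected) {f : ℝ → ℝ}
    (hf : ∀ t ∈ J, HasDerivAt f 0 t) {s t : ℝ} (hs : s ∈ J) (ht : t ∈ J) : f s = f t :=
  hJ.is_const_of_deriv_eq_zero hJ'.isPreconnected
    (fun t ht => (hf t ht).differentiableAt.differentiableWithinAt) (fun t ht => (hf t ht).deriv)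
    hs ht

/-- `X` is an integral curve on `J` of the time-dependent vector field `u`. -/
def IsTrajectory (J : Set ℝ) (u : ℝ → ℝ → ℝ) (X : ℝ → ℝ) : Prop :=
  ∀ t ∈ J, HasDerivAt X (u t (X t)) t

namespace IsTrajectory

variable {J : Set ℝ} {u : ℝ → ℝ → ℝ} {X Y : ℝ → ℝ}

theorem continuousOn (hX : IsTrajectory J u X) : ContinuousOn X J :=
  fun t ht => (hX t ht).continuousAt.continuousWithinAt

theorem continuousOn_secantSlope (hJ : IsOpen J) (hu : SmoothOnStrip J u)
    (hX : IsTrajectory J u X) (hY : IsTrajectory J u Y) :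
    ContinuousOn (fun s => secantSlope u s (X s) (Y s)) J :=
  ContinuousOn.comp (g := fun p : ℝ × ℝ × ℝ => secantSlope u p.1 p.2.1 p.2.2)
    (f := fun s => (s, X s, Y s)) (_root_.continuousOn_secantSlope hJ hu)
    (continuousOn_id.prodMk (hX.continuousOn.prodMk hY.continuousOn))
    fun _ hs => ⟨hs, mem_univ _⟩

/-- The difference `z` of two trajectories satisfies `ż = a z` with `a` the secant slope. This
explicit solution does the work of Grönwall's inequality, and it also yields the derivative of the
flow in the initial point. -/
theorem sub_eq (hJ : IsOpen J) (hJ' : J.OrdConnected) (hu : SmoothOnStrip J u)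
    (hX : IsTrajectory J u X) (hY : IsTrajectory J u Y) {s t : ℝ} (hs : s ∈ J) (ht : t ∈ J) :
    Y t - X t = (Y s - X s) * Real.exp (∫ r in s..t, secantSlope u r (X r) (Y r)) := by
  have hc := hX.continuousOn_secantSlope hJ hu hY
  have key := eq_of_hasDerivAt_zero hJ hJ' (f := fun t => (Y t - X t) *
    Real.exp (-∫ r in s..t, secantSlope u r (X r) (Y r))) (fun t ht => by
      have h1 := ((hY t ht).sub (hX t ht)).mul (hasDerivAt_primitive hJ hJ' hc hs ht).neg.exp
      refine h1.congr_deriv ?_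
      rw [sub_eq_mul_secantSlope hJ hu ht]
      simp only [Pi.sub_apply, Pi.neg_apply]
      ring) hs ht
  simp only [intervalIntegral.integral_same, neg_zero, Real.exp_zero, mul_one] at key
  rw [key, mul_assoc, ← Real.exp_add]
  simp

theorem unique (hJ : IsOpen J) (hJ' : J.OrdConnected) (hu : SmoothOnStrip J u)
    (hX : IsTrajectory J u X) (hY : IsTrajectory J u Y) {s t : ℝ} (hs : s ∈ J) (h : X s = Y s)
    (ht : t ∈ J) : X t = Y t := by
  have := sub_eq hJ hJ' hu hX hY hs ht
  rw [h, sub_self, zero_mul] at this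
  linarith

end IsTrajectory

theorem SmoothOnStrip.mono {I J : Set ℝ} {f : ℝ → ℝ → ℝ} (hf : SmoothOnStrip J f) (h : I ⊆ J) :
    SmoothOnStrip I f := ContDiffOn.mono hf (prod_mono h le_rfl)

/-- By periodicity `u` and `u_x` are bounded on `[a, b] × ℝ`. Picard–Lindelöf with radius `M * (b -
a)` then covers the whole interval at once, with no continuation argument. -/
theorem exists_trajectory_Ioo {J : Set ℝ} (hJ : IsOpen J) {u : ℝ → ℝ → ℝ}
    (hu : SmoothOnStrip J u) (hp : ∀ t ∈ J, Function.Periodic (u t) 1) {a b t₀ : ℝ}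
    (hab : Icc a b ⊆ J) (ht₀ : t₀ ∈ Icc a b) (x₀ : ℝ) :
    ∃ X : ℝ → ℝ, X t₀ = x₀ ∧ IsTrajectory (Ioo a b) u X := by
  obtain ⟨M, hM0, hM⟩ := hu.exists_bound hp hab
  obtain ⟨K, hK0, hK⟩ := (hu.partialSpace hJ).exists_bound (periodic_partialSpace hp) hab
  have hba : 0 ≤ b - a := by linarith [ht₀.1, ht₀.2]
  have hPL : IsPicardLindelof u (⟨t₀, ht₀⟩ : Icc a b) x₀
      (⟨M * (b - a), mul_nonneg hM0 hba⟩ : ℝ≥0) 0 ⟨M, hM0⟩ ⟨K, hK0⟩ :=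
    { lipschitzOnWith := fun t ht => (lipschitzWith_of_nnnorm_deriv_le
        (fun x => (hu.hasDerivAt_space hJ (hab ht) x).differentiableAt)
        fun x => hK t ht x).lipschitzOnWith
      continuousOn := fun x _ => ((hu.time_slice x).continuousOn).mono hab
      norm_le := fun t ht x _ => hM t ht x
      mul_max_le := by
        simp only [NNReal.coe_zero, sub_zero]
        exact mul_le_mul_of_nonneg_left (max_le (by linarith [ht₀.1]) (by linarith [ht₀.2])) hM0 }
  obtain ⟨X, hX0, hX⟩ := hPL.exists_eq_forall_mem_Icc_hasDerivWithinAt₀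
  exact ⟨X, hX0, fun t ht => (hX t (Ioo_subset_Icc_self ht)).hasDerivAt (Icc_mem_nhds ht.1 ht.2)⟩

theorem exists_Ioo_mem {J : Set ℝ} (hJ : IsOpen J) (hJ' : J.OrdConnected) {s t : ℝ} (hs : s ∈ J)
    (ht : t ∈ J) : ∃ a b, Icc a b ⊆ J ∧ s ∈ Ioo a b ∧ t ∈ Ioo a b := by
  have hmin : min s t ∈ J := by rcases min_choice s t with h | h <;> rw [h] <;> assumption
  have hmax : max s t ∈ J := by rcases max_choice s t with h | h <;> rw [h] <;> assumption
  obtain ⟨ε, hε, hb⟩ := Metric.isOpen_iff.1 hJ _ hmin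
  obtain ⟨δ, hδ, hb'⟩ := Metric.isOpen_iff.1 hJ _ hmax
  refine ⟨min s t - ε / 2, max s t + δ / 2, hJ'.out (hb ?_) (hb' ?_), ⟨?_, ?_⟩, ⟨?_, ?_⟩⟩
  · rw [Metric.mem_ball, Real.dist_eq, abs_lt]; constructor <;> linarith
  · rw [Metric.mem_ball, Real.dist_eq, abs_lt]; constructor <;> linarith
  · linarith [min_le_left s t]
  · linarith [le_max_left s t]
  · linarith [min_le_right s t]
  · linarith [le_max_right s t]

theorem exists_trajectory {J : Set ℝ} (hJ : IsOpen J) (hJ' : J.OrdConnected) {u : ℝ → ℝ → ℝ}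
    (hu : SmoothOnStrip J u) (hp : ∀ t ∈ J, Function.Periodic (u t) 1) {t₀ : ℝ}
    (ht₀ : t₀ ∈ J) (x₀ : ℝ) :
    ∃ X : ℝ → ℝ, X t₀ = x₀ ∧ IsTrajectory J u X := by
  have hex : ∀ t : ℝ, ∃ a b : ℝ, ∃ X : ℝ → ℝ, t ∈ J → Icc a b ⊆ J ∧ t₀ ∈ Ioo a b ∧ t ∈ Ioo a b ∧
      X t₀ = x₀ ∧ IsTrajectory (Ioo a b) u X := by
    intro t
    by_cases ht : t ∈ J
    · obtain ⟨a, b, hab, h0, h1⟩ := exists_Ioo_mem hJ hJ' ht₀ ht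
      obtain ⟨X, hX0, hX⟩ := exists_trajectory_Ioo hJ hu hp hab (Ioo_subset_Icc_self h0) x₀
      exact ⟨a, b, X, fun _ => ⟨hab, h0, h1, hX0, hX⟩⟩
    · exact ⟨0, 0, 0, fun h => absurd h ht⟩
  choose a b X h using hex
  -- The value at `t` is taken from the solution chosen for `t`. All chosen intervals contain `t₀`,
  -- so neighbouring choices agree by uniqueness.
  refine ⟨fun t => X t t, (h t₀ ht₀).2.2.2.1, fun t ht => ?_⟩
  obtain ⟨hab, h0, h1, hX0, hX⟩ := h t ht
  refine (hX t h1).congr_of_eventuallyEq ?_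
  filter_upwards [isOpen_Ioo.mem_nhds h1] with s hs
  obtain ⟨hab', h0', h1', hX0', hX'⟩ := h s (hab (Ioo_subset_Icc_self hs))
  refine IsTrajectory.unique (J := Ioo (a s) (b s) ∩ Ioo (a t) (b t)) (isOpen_Ioo.inter isOpen_Ioo)
    (ordConnected_Ioo.inter ordConnected_Ioo)
    (hu.mono (inter_subset_right.trans (Ioo_subset_Icc_self.trans hab)))
    (fun r hr => hX' r hr.1) (fun r hr => hX r hr.2) ⟨h0', h0⟩ (hX0'.trans hX0.symm) ⟨h1', hs⟩

/-- Mere continuity of `g` suffices, because the other factor vanishes at the point: replacing `g`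
by its value there costs `O(h) · o(1)`. -/
theorem hasFDerivAt_sub_mul_of_continuousAt {g : ℝ × ℝ → ℝ} {t x : ℝ}
    (hg : ContinuousAt g (t, x)) :
    HasFDerivAt (fun p : ℝ × ℝ => (p.2 - x) * g p) (g (t, x) • ContinuousLinearMap.snd ℝ ℝ ℝ)
      (t, x) := by
  refine .of_isLittleO ?_
  have h1 : (fun p : ℝ × ℝ => p.2 - x) =O[𝓝 (t, x)] fun p => p - (t, x) :=
    .of_bound 1 (.of_forall fun p => by
      rw [one_mul]; exact norm_snd_le (p - (t, x)))
  have h2 : (fun p : ℝ × ℝ => g p - g (t, x)) =o[𝓝 (t, x)] fun _ => (1 : ℝ) := by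
    rw [Asymptotics.isLittleO_one_iff]
    simpa using hg.tendsto.sub_const (g (t, x))
  refine ((h1.norm_right.mul_isLittleO h2).congr_left fun p => ?_).trans_isBigO
    (.of_bound 1 (.of_forall fun p => by simp))
  simp only [FunLike.coe_smul, Pi.smul_apply, ContinuousLinearMap.coe_snd', smul_eq_mul,
    Prod.snd_sub]
  ring

/-- `X` is the flow on `J` of the time-dependent vector field `u`, starting at time `t₀`. -/
structure IsFlow (J : Set ℝ) (t₀ : ℝ) (u X : ℝ → ℝ → ℝ) : Prop where
  initial : ∀ x, X t₀ x = x
  trajectory : ∀ x, IsTrajectory J u fun t => X t x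

namespace IsFlow

variable {J : Set ℝ} {u X : ℝ → ℝ → ℝ} {t₀ : ℝ}

theorem sub_eq (hJ : IsOpen J) (hJ' : J.OrdConnected) (hu : SmoothOnStrip J u) (ht₀ : t₀ ∈ J)
    (hX : IsFlow J t₀ u X) {t : ℝ} (ht : t ∈ J) (x y : ℝ) :
    X t y - X t x = (y - x) *
      Real.exp (∫ r in t₀..t, secantSlope u r (X r x) (X r y)) := by
  rw [(hX.trajectory x).sub_eq hJ hJ' hu (hX.trajectory y) ht₀ ht, hX.initial, hX.initial]

/-- The exponential formula makes `X s` Lipschitz in space, uniformly for `s` in a compact interval;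
a single trajectory is continuous in time. -/
theorem continuousOn (hJ : IsOpen J) (hJ' : J.OrdConnected) (hu : SmoothOnStrip J u)
    (hp : ∀ t ∈ J, Function.Periodic (u t) 1) (ht₀ : t₀ ∈ J) (hX : IsFlow J t₀ u X) :
    ContinuousOn (fun p : ℝ × ℝ => X p.1 p.2) (J ×ˢ univ) := by
  rintro ⟨t, x⟩ ⟨ht, -⟩
  refine ContinuousAt.continuousWithinAt ?_
  obtain ⟨a, b, hab, h0, h1⟩ := exists_Ioo_mem hJ hJ' ht₀ ht
  obtain ⟨K, hK0, hK⟩ := (hu.partialSpace hJ).exists_bound (periodic_partialSpace hp) hab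
  have hexp : ∀ s ∈ Ioo a b, ∀ y, |X s y - X s x| ≤ Real.exp (K * (b - a)) * |y - x| := by
    intro s hs y
    rw [hX.sub_eq hJ hJ' hu ht₀ (hab (Ioo_subset_Icc_self hs)), abs_mul, Real.abs_exp, mul_comm]
    refine mul_le_mul_of_nonneg_right (Real.exp_le_exp.2 ?_) (abs_nonneg _)
    have := intervalIntegral.norm_integral_le_of_norm_le_const (a := t₀) (b := s)
      (f := fun r => secantSlope u r (X r x) (X r y)) (C := K) fun r hr =>
        abs_secantSlope_le (hK r (uIcc_subset_Icc (Ioo_subset_Icc_self h0)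
          (Ioo_subset_Icc_self hs) (uIoc_subset_uIcc hr))) _ _
    refine (le_abs_self _).trans (this.trans (mul_le_mul_of_nonneg_left ?_ hK0))
    rw [abs_le]
    constructor <;> linarith [hs.1, hs.2, h0.1, h0.2]
  have hd : Tendsto (fun p : ℝ × ℝ => X p.1 p.2 - X p.1 x) (𝓝 (t, x)) (𝓝 0) := by
    refine squeeze_zero_norm' (a := fun p : ℝ × ℝ => Real.exp (K * (b - a)) * |p.2 - x|) ?_ ?_
    · filter_upwards [(isOpen_Ioo.prod isOpen_univ).mem_nhds (mk_mem_prod h1 (mem_univ x))] with p hp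
      exact hexp p.1 hp.1 p.2
    · have : Continuous fun p : ℝ × ℝ => Real.exp (K * (b - a)) * |p.2 - x| := by fun_prop
      simpa using this.tendsto (t, x)
  have hx : Tendsto (fun p : ℝ × ℝ => X p.1 x) (𝓝 (t, x)) (𝓝 (X t x)) :=
    ((hX.trajectory x t ht).continuousAt.tendsto.comp
      (continuous_fst.tendsto ((t, x) : ℝ × ℝ)) :)
  have := hd.add hx
  simpa [ContinuousAt] using this

/-- Write `X s y = X s x + (y - x) exp(∫ secant slope)`. The exponential is continuous in `(s, y)`,
and at `y = x` the secant slope becomes `u_x`. -/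
theorem hasFDerivAt (hJ : IsOpen J) (hJ' : J.OrdConnected) (hu : SmoothOnStrip J u)
    (hp : ∀ t ∈ J, Function.Periodic (u t) 1) (ht₀ : t₀ ∈ J) (hX : IsFlow J t₀ u X)
    {t : ℝ} (ht : t ∈ J) (x : ℝ) :
    HasFDerivAt (fun p : ℝ × ℝ => X p.1 p.2)
      (u t (X t x) • ContinuousLinearMap.fst ℝ ℝ ℝ +
        Real.exp (∫ r in t₀..t, partialSpace u r (X r x)) • ContinuousLinearMap.snd ℝ ℝ ℝ)
      (t, x) := by
  have hc := hX.continuousOn hJ hJ' hu hp ht₀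
  have hsec : ContinuousOn (fun p : ℝ × ℝ => secantSlope u p.1 (X p.1 x) (X p.1 p.2))
      (J ×ˢ univ) :=
    ContinuousOn.comp (g := fun p : ℝ × ℝ × ℝ => secantSlope u p.1 p.2.1 p.2.2)
      (f := fun p : ℝ × ℝ => (p.1, X p.1 x, X p.1 p.2)) (continuousOn_secantSlope hJ hu)
      (continuousOn_fst.prodMk (ContinuousOn.prodMk
        ((hX.trajectory x).continuousOn.comp continuousOn_fst fun p hp => hp.1) hc))
      fun _ hs => ⟨hs.1, mem_univ _⟩
  have hprim := (contDiffOn_primitive_time (n := 0) hJ hJ' ht₀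
    (f := fun r y => secantSlope u r (X r x) (X r y)) (contDiffOn_zero.2 hsec)).continuousOn
  have hg : ContinuousAt (fun p : ℝ × ℝ =>
      Real.exp (∫ r in t₀..p.1, secantSlope u r (X r x) (X r p.2))) (t, x) :=
    (Real.continuous_exp.comp_continuousOn hprim).continuousAt
      ((hJ.prod isOpen_univ).mem_nhds ⟨ht, mem_univ _⟩)
  have h1 := hasFDerivAt_sub_mul_of_continuousAt hg
  have h2 : HasFDerivAt (fun p : ℝ × ℝ => X p.1 x)
      (u t (X t x) • ContinuousLinearMap.fst ℝ ℝ ℝ) (t, x) :=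
    HasDerivAt.comp_hasFDerivAt (f := Prod.fst) ((t, x) : ℝ × ℝ) (hX.trajectory x t ht)
      hasFDerivAt_fst
  have h3 := h2.add h1
  simp only [secantSlope_self] at h3
  refine h3.congr_of_eventuallyEq ?_
  filter_upwards [(hJ.prod isOpen_univ).mem_nhds (mk_mem_prod ht (mem_univ x))] with p hp
  have := hX.sub_eq hJ hJ' hu ht₀ hp.1 x p.2
  simp only [Pi.add_apply]
  rw [← this]
  ring

/-- The flow of a smooth vector field on the circle is smooth. -/
theorem smoothOnStrip (hJ : IsOpen J) (hJ' : J.OrdConnected) (hu : SmoothOnStrip J u)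
    (hp : ∀ t ∈ J, Function.Periodic (u t) 1) (ht₀ : t₀ ∈ J) (hX : IsFlow J t₀ u X) :
    SmoothOnStrip J X := by
  refine contDiffOn_infty.2 fun n => ?_
  induction n with
  | zero => exact contDiffOn_zero.2 (hX.continuousOn hJ hJ' hu hp ht₀)
  | succ n ih =>
    have hd := fun (p : ℝ × ℝ) (h : p ∈ J ×ˢ univ) => hX.hasFDerivAt hJ hJ' hu hp ht₀ h.1 p.2
    have hcomp : ∀ {f : ℝ → ℝ → ℝ}, SmoothOnStrip J f →
        ContDiffOn ℝ n (fun p : ℝ × ℝ => f p.1 (X p.1 p.2)) (J ×ˢ univ) := fun {f} hf =>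
      ContDiffOn.comp (g := fun p : ℝ × ℝ => f p.1 p.2) (f := fun p : ℝ × ℝ => (p.1, X p.1 p.2))
        (contDiffOn_infty.1 hf n) (contDiffOn_fst.prodMk ih) fun _ hp => ⟨hp.1, mem_univ _⟩
    push_cast
    rw [contDiffOn_succ_iff_fderiv_of_isOpen (hJ.prod isOpen_univ)]
    refine ⟨fun p h => (hd p h).differentiableAt.differentiableWithinAt, by simp, ?_⟩
    -- The derivative involves only `X` inside smooth functions and under a time integral, so it is
    -- as regular as `X`: bootstrap.
    refine ContDiffOn.congr (((hcomp hu).smul contDiffOn_const).add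
      (ContDiffOn.smul (ContDiffOn.exp (contDiffOn_primitive_time (n := n) hJ hJ' ht₀
        (f := fun r x => partialSpace u r (X r x)) (hcomp (hu.partialSpace hJ))))
        contDiffOn_const)) fun p h => (hd p h).fderiv

theorem partialSpace_pos (hJ : IsOpen J) (hJ' : J.OrdConnected) (hu : SmoothOnStrip J u)
    (hp : ∀ t ∈ J, Function.Periodic (u t) 1) (ht₀ : t₀ ∈ J) (hX : IsFlow J t₀ u X)
    {t : ℝ} (ht : t ∈ J) (x : ℝ) : 0 < partialSpace X t x := by
  have h := hX.hasFDerivAt hJ hJ' hu hp ht₀ ht x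
  have := (hasDerivAt_snd_of_differentiableAt h.differentiableAt).deriv
  rw [partialSpace, this, h.fderiv]
  simpa using Real.exp_pos _

theorem add_one (hJ : IsOpen J) (hJ' : J.OrdConnected) (hu : SmoothOnStrip J u)
    (hp : ∀ t ∈ J, Function.Periodic (u t) 1) (ht₀ : t₀ ∈ J) (hX : IsFlow J t₀ u X)
    {t : ℝ} (ht : t ∈ J) (x : ℝ) : X t (x + 1) = X t x + 1 := by
  refine IsTrajectory.unique hJ hJ' hu (hX.trajectory (x + 1)) (Y := fun t => X t x + 1) ?_ ht₀
    (by simp [hX.initial]) ht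
  intro s hs
  rw [hp s hs]
  exact (hX.trajectory x s hs).add_const 1

end IsFlow

theorem exists_flow {J : Set ℝ} (hJ : IsOpen J) (hJ' : J.OrdConnected) {u : ℝ → ℝ → ℝ}
    (hu : SmoothOnStrip J u) (hp : ∀ t ∈ J, Function.Periodic (u t) 1) {t₀ : ℝ}
    (ht₀ : t₀ ∈ J) : ∃ X : ℝ → ℝ → ℝ, IsFlow J t₀ u X := by
  choose X h1 h2 using exists_trajectory hJ hJ' hu hp ht₀
  exact ⟨fun t x => X x t, h1, h2⟩

/-! ### Smooth families of functions of time and space -/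

/-- Smoothness on `S × J × ℝ` of a family of functions of time and space. -/
def SmoothFamily (S J : Set ℝ) (f : ℝ → ℝ → ℝ → ℝ) : Prop :=
  ContDiffOn ℝ ∞ (fun p : ℝ × ℝ × ℝ => f p.1 p.2.1 p.2.2) (S ×ˢ J ×ˢ univ)

namespace SmoothFamily

variable {S J : Set ℝ} {f g : ℝ → ℝ → ℝ → ℝ}

theorem contDiffAt (hS : IsOpen S) (hJ : IsOpen J) (hf : SmoothFamily S J f) {s t : ℝ}
    (hs : s ∈ S) (ht : t ∈ J) (x : ℝ) :
    ContDiffAt ℝ ∞ (fun p : ℝ × ℝ × ℝ => f p.1 p.2.1 p.2.2) (s, t, x) :=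
  ContDiffOn.contDiffAt hf ((hS.prod (hJ.prod isOpen_univ)).mem_nhds ⟨hs, ht, mem_univ x⟩)

theorem add (hf : SmoothFamily S J f) (hg : SmoothFamily S J g) :
    SmoothFamily S J fun s t x => f s t x + g s t x := ContDiffOn.add hf hg

theorem sub (hf : SmoothFamily S J f) (hg : SmoothFamily S J g) :
    SmoothFamily S J fun s t x => f s t x - g s t x := ContDiffOn.sub hf hg

theorem mul (hf : SmoothFamily S J f) (hg : SmoothFamily S J g) :
    SmoothFamily S J fun s t x => f s t x * g s t x := ContDiffOn.mul hf hg

theorem pow (hf : SmoothFamily S J f) (n : ℕ) :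
    SmoothFamily S J fun s t x => f s t x ^ n := ContDiffOn.pow hf n

theorem exp (hf : SmoothFamily S J f) :
    SmoothFamily S J fun s t x => Real.exp (f s t x) := ContDiffOn.exp hf

theorem div (hf : SmoothFamily S J f) (hg : SmoothFamily S J g)
    (h : ∀ s ∈ S, ∀ t ∈ J, ∀ x, g s t x ≠ 0) :
    SmoothFamily S J fun s t x => f s t x / g s t x :=
  ContDiffOn.div hf hg fun p hp => h p.1 hp.1 p.2.1 hp.2.1 p.2.2

theorem of_strip {h : ℝ → ℝ → ℝ} (hh : SmoothOnStrip J h) : SmoothFamily S J fun _ t x => h t x :=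
  ContDiffOn.comp (g := fun p : ℝ × ℝ => h p.1 p.2) (f := fun p : ℝ × ℝ × ℝ => p.2) hh
    contDiffOn_snd fun _ hp => hp.2

theorem of_param : SmoothFamily S J fun s _ _ => s := contDiffOn_fst

theorem of_param_time {h : ℝ → ℝ → ℝ}
    (hh : ContDiffOn ℝ ∞ (fun p : ℝ × ℝ => h p.1 p.2) (S ×ˢ J)) :
    SmoothFamily S J fun s t _ => h s t :=
  ContDiffOn.comp (g := fun p : ℝ × ℝ => h p.1 p.2) (f := fun p : ℝ × ℝ × ℝ => (p.1, p.2.1)) hh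
    (by fun_prop) fun _ hp => ⟨hp.1, hp.2.1⟩

theorem slice (hf : SmoothFamily S J f) {s : ℝ} (hs : s ∈ S) : SmoothOnStrip J (f s) :=
  ContDiffOn.comp (g := fun p : ℝ × ℝ × ℝ => f p.1 p.2.1 p.2.2) (f := fun p : ℝ × ℝ => (s, p)) hf
    (by fun_prop) fun _ hp => ⟨hs, hp⟩

theorem time_slice (hf : SmoothFamily S J f) {t : ℝ} (ht : t ∈ J) :
    SmoothOnStrip S fun s x => f s t x :=
  ContDiffOn.comp (g := fun p : ℝ × ℝ × ℝ => f p.1 p.2.1 p.2.2)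
    (f := fun p : ℝ × ℝ => (p.1, t, p.2)) hf (by fun_prop) fun _ hp => ⟨hp.1, ht, hp.2⟩

theorem integral (hS : IsOpen S) (hJ : IsOpen J) (hf : SmoothFamily S J f) (a b : ℝ) :
    ContDiffOn ℝ ∞ (fun p : ℝ × ℝ => ∫ x in a..b, f p.1 p.2 x) (S ×ˢ J) := by
  have hc : ContDiff ℝ ∞ (fun q : (ℝ × ℝ) × ℝ => (q.1.1, q.1.2, q.2)) := by fun_prop
  exact contDiffOn_intervalIntegral (n := ⊤) (hS.prod hJ)
    (W := (fun q : (ℝ × ℝ) × ℝ => (q.1.1, q.1.2, q.2)) ⁻¹' (S ×ˢ J ×ˢ univ))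
    ((hS.prod (hJ.prod isOpen_univ)).preimage hc.continuous)
    (fun p hp r _ => ⟨hp.1, hp.2, mem_univ _⟩)
    (f := fun p x => f p.1 p.2 x) (ContDiffOn.comp hf hc.contDiffOn fun q hq => hq)

theorem hasDerivAt_line {F : ℝ × ℝ × ℝ → ℝ} {p : ℝ × ℝ × ℝ} (hF : ContDiffAt ℝ ∞ F p)
    {c : ℝ → ℝ × ℝ × ℝ} {c' : ℝ × ℝ × ℝ} {τ : ℝ} (hc : HasDerivAt c c' τ) (h : c τ = p) :
    HasDerivAt (fun r => F (c r)) (fderiv ℝ F p c') τ := by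
  subst h
  exact (hF.differentiableAt (by simp)).hasFDerivAt.comp_hasDerivAt τ hc

theorem contDiffOn_fderiv_apply (hS : IsOpen S) (hJ : IsOpen J) (hf : SmoothFamily S J f)
    (v : ℝ × ℝ × ℝ) :
    ContDiffOn ℝ ∞ (fun p => fderiv ℝ (fun p : ℝ × ℝ × ℝ => f p.1 p.2.1 p.2.2) p v)
      (S ×ˢ J ×ˢ univ) :=
  (ContDiffOn.fderiv_of_isOpen hf (hS.prod (hJ.prod isOpen_univ)) (by simp)).clm_apply
    contDiffOn_const

protected theorem partialTime (hS : IsOpen S) (hJ : IsOpen J) (hf : SmoothFamily S J f) :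
    SmoothFamily S J fun s => partialTime (f s) :=
  (hf.contDiffOn_fderiv_apply hS hJ (0, 1, 0)).congr fun p hp =>
    (hasDerivAt_line (hf.contDiffAt hS hJ hp.1 hp.2.1 p.2.2) (c := fun τ => (p.1, τ, p.2.2))
      ((hasDerivAt_const _ _).prodMk ((hasDerivAt_id _).prodMk (hasDerivAt_const _ _))) rfl).deriv

theorem deriv_param (hS : IsOpen S) (hJ : IsOpen J) (hf : SmoothFamily S J f) {s : ℝ}
    (hs : s ∈ S) : SmoothOnStrip J fun t x => deriv (fun s => f s t x) s :=
  (ContDiffOn.comp (g := fun p => fderiv ℝ (fun p : ℝ × ℝ × ℝ => f p.1 p.2.1 p.2.2) p (1, 0, 0))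
    (f := fun p : ℝ × ℝ => (s, p)) (hf.contDiffOn_fderiv_apply hS hJ (1, 0, 0))
    (by fun_prop) (t := S ×ˢ J ×ˢ univ) (s := J ×ˢ univ) fun _ hp => ⟨hs, hp⟩).congr fun p hp =>
    (hasDerivAt_line (hf.contDiffAt hS hJ hs hp.1 p.2) (c := fun τ => (τ, p.1, p.2))
      ((hasDerivAt_id _).prodMk (hasDerivAt_const _ _)) rfl).deriv

theorem hasDerivAt_param (hS : IsOpen S) (hf : SmoothFamily S J f) {s t : ℝ}
    (hs : s ∈ S) (ht : t ∈ J) (x : ℝ) :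
    HasDerivAt (fun s => f s t x) (deriv (fun s => f s t x) s) s :=
  (hf.time_slice ht).hasDerivAt_time hS hs x

theorem deriv_param_comm (hS : IsOpen S) (hJ : IsOpen J) (hf : SmoothFamily S J f) {s t : ℝ}
    (hs : s ∈ S) (ht : t ∈ J) (x : ℝ) :
    deriv (fun s => partialTime (f s) t x) s =
      partialTime (fun t x => deriv (fun s => f s t x) s) t x := by
  have hc : ContDiffAt ℝ ∞ (fun p : ℝ × ℝ => (p.1, p.2, x)) (s, t) := by fun_prop
  exact deriv_deriv_comm (f := fun s t => f s t x)
    (ContDiffAt.comp (s, t) (g := fun p : ℝ × ℝ × ℝ => f p.1 p.2.1 p.2.2)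
      (f := fun p : ℝ × ℝ => (p.1, p.2, x)) (hf.contDiffAt hS hJ hs ht x) hc)

end SmoothFamily

/-! ### First variation of the energy -/

/-- The relative rate of change `ρ̇ / ρ` of a curve of densities. -/
noncomputable def logDensityRate (ρ : ℝ → ℝ → ℝ) (t x : ℝ) : ℝ := partialTime ρ t x / ρ t x

/-- The mean `∫ θ̇ ρ dx`. -/
noncomputable def meanRate (ρ θ : ℝ → ℝ → ℝ) (t : ℝ) : ℝ :=
  ∫ y in (0 : ℝ)..1, partialTime θ t y * ρ t y

/-- The representative of `θ̇`, modulo constants, with vanishing integral against `ρ dx`. -/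
noncomputable def normalizedRate (ρ θ : ℝ → ℝ → ℝ) (t x : ℝ) : ℝ :=
  partialTime θ t x - meanRate ρ θ t

/-- The density component `2 (ρ̇/ρ)˙ + (ρ̇/ρ)² - θ̇²` of the geodesic equation. -/
noncomputable def geodesicDensity (ρ θ : ℝ → ℝ → ℝ) (t x : ℝ) : ℝ :=
  2 * partialTime (logDensityRate ρ) t x + logDensityRate ρ t x ^ 2 - normalizedRate ρ θ t x ^ 2

/-- The rate of change of the momentum `θ̇ ρ` of the fibre component. -/
noncomputable def momentumRate (ρ θ : ℝ → ℝ → ℝ) : ℝ → ℝ → ℝ :=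
  partialTime fun t x => normalizedRate ρ θ t x * ρ t x

section StripRates

variable {J : Set ℝ} {ρ θ : ℝ → ℝ → ℝ}

theorem smoothOnStrip_logDensityRate (hJ : IsOpen J) (hρ : SmoothOnStrip J ρ)
    (hpos : ∀ t ∈ J, ∀ x, 0 < ρ t x) : SmoothOnStrip J (logDensityRate ρ) :=
  (hρ.partialTime hJ).div hρ fun t ht x => (hpos t ht x).ne'

theorem contDiffOn_meanRate (hJ : IsOpen J) (hρ : SmoothOnStrip J ρ) (hθ : SmoothOnStrip J θ) :
    ContDiffOn ℝ ∞ (meanRate ρ θ) J :=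
  ((hθ.partialTime hJ).mul hρ).integral hJ 0 1

theorem smoothOnStrip_normalizedRate (hJ : IsOpen J) (hρ : SmoothOnStrip J ρ)
    (hθ : SmoothOnStrip J θ) : SmoothOnStrip J (normalizedRate ρ θ) :=
  (hθ.partialTime hJ).sub (.of_time (contDiffOn_meanRate hJ hρ hθ))

theorem smoothOnStrip_geodesicDensity (hJ : IsOpen J) (hρ : SmoothOnStrip J ρ)
    (hθ : SmoothOnStrip J θ) (hpos : ∀ t ∈ J, ∀ x, 0 < ρ t x) :
    SmoothOnStrip J (geodesicDensity ρ θ) :=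
  ((((smoothOnStrip_logDensityRate hJ hρ hpos).partialTime hJ).const_mul 2).add
    ((smoothOnStrip_logDensityRate hJ hρ hpos).pow 2)).sub
    ((smoothOnStrip_normalizedRate hJ hρ hθ).pow 2)

theorem smoothOnStrip_momentumRate (hJ : IsOpen J) (hρ : SmoothOnStrip J ρ)
    (hθ : SmoothOnStrip J θ) : SmoothOnStrip J (momentumRate ρ θ) :=
  ((smoothOnStrip_normalizedRate hJ hρ hθ).mul hρ).partialTime hJ

/-- Since `ρ` has mass one, subtracting the mean makes the rate orthogonal to constants. This
removes every contribution of the choice of fibre constants to the first variation. -/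
theorem integral_normalizedRate_mul (hJ : IsOpen J) (hρ : SmoothOnStrip J ρ)
    (hθ : SmoothOnStrip J θ) {t : ℝ} (ht : t ∈ J) (h1 : ∫ x in (0 : ℝ)..1, ρ t x = 1) :
    ∫ x in (0 : ℝ)..1, normalizedRate ρ θ t x * ρ t x = 0 := by
  simp only [normalizedRate, sub_mul]
  rw [intervalIntegral.integral_sub (((hθ.partialTime hJ).mul hρ).intervalIntegrable ht 0 1)
    ((hρ.intervalIntegrable ht 0 1).const_mul _), intervalIntegral.integral_const_mul, h1, meanRate]
  ring

end StripRates

/-- The boundary term of the first variation of the energy. -/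
noncomputable def boundaryPairing (ρ θ r q : ℝ → ℝ → ℝ) (t : ℝ) : ℝ :=
  ∫ x in (0 : ℝ)..1, (2 * (logDensityRate ρ t x * r t x) +
    2 * ((normalizedRate ρ θ t x * ρ t x) * q t x))

/-- The pairing of a variation `(r, q)` with the geodesic equation. -/
noncomputable def geodesicPairing (ρ θ r q : ℝ → ℝ → ℝ) (t : ℝ) : ℝ :=
  ∫ x in (0 : ℝ)..1, (geodesicDensity ρ θ t x * r t x + 2 * (momentumRate ρ θ t x * q t x))

theorem SmoothOnStrip.continuousOn_integral {J : Set ℝ} (hJ : IsOpen J) {f : ℝ → ℝ → ℝ}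
    (hf : SmoothOnStrip J f) (a b : ℝ) : ContinuousOn (fun t => ∫ x in a..b, f t x) J :=
  (hf.integral hJ a b).continuousOn

/-- The first variation formula for the Sasaki-Fisher-Rao energy. -/
theorem hasDerivAt_sasakiEnergy {S J : Set ℝ} (hS : IsOpen S) (hJ : IsOpen J)
    (hJ' : J.OrdConnected) {R T : ℝ → ℝ → ℝ → ℝ} (hR : SmoothFamily S J R)
    (hT : SmoothFamily S J T) (hpos : ∀ s ∈ S, ∀ t ∈ J, ∀ x, 0 < R s t x) {s₀ : ℝ} (hs₀ : s₀ ∈ S)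
    (hint : ∀ t ∈ J, ∫ x in (0 : ℝ)..1, R s₀ t x = 1) {a b : ℝ} (ha : a ∈ J) (hb : b ∈ J)
    {r q : ℝ → ℝ → ℝ} (hr : ∀ t x, r t x = deriv (fun s => R s t x) s₀)
    (hq : ∀ t x, q t x = deriv (fun s => T s t x) s₀) :
    HasDerivAt (fun s => sasakiEnergy a b (R s) (T s))
      (1 / 8 * (boundaryPairing (R s₀) (T s₀) r q b - boundaryPairing (R s₀) (T s₀) r q a -
        ∫ t in a..b, geodesicPairing (R s₀) (T s₀) r q t)) s₀ := by
  obtain rfl : r = fun t x => deriv (fun s => R s t x) s₀ := by ext; apply hr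
  obtain rfl : q = fun t x => deriv (fun s => T s t x) s₀ := by ext; apply hq
  set r := fun t x => deriv (fun s => R s t x) s₀ with hr_def
  set q := fun t x => deriv (fun s => T s t x) s₀ with hq_def
  have hRt := hR.partialTime hS hJ
  have hTt := hT.partialTime hS hJ
  have hm : SmoothFamily S J fun s t _ => meanRate (R s) (T s) t :=
    .of_param_time ((hTt.mul hR).integral hS hJ 0 1)
  have hw : SmoothFamily S J fun s => logDensityRate (R s) :=
    hRt.div hR fun s hs t ht x => (hpos s hs t ht x).ne'
  have hv : SmoothFamily S J fun s => normalizedRate (R s) (T s) := hTt.sub hm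
  have hF : SmoothFamily S J fun s t x =>
      (logDensityRate (R s) t x ^ 2 + normalizedRate (R s) (T s) t x ^ 2) * R s t x :=
    ((hw.pow 2).add (hv.pow 2)).mul hR
  have hρ := hR.slice hs₀
  have hθ := hT.slice hs₀
  have hpos₀ := hpos s₀ hs₀
  have hrs : SmoothOnStrip J r := hR.deriv_param hS hJ hs₀
  have hqs : SmoothOnStrip J q := hT.deriv_param hS hJ hs₀
  have hw₀ := smoothOnStrip_logDensityRate hJ hρ hpos₀
  have hv₀ := smoothOnStrip_normalizedRate hJ hρ hθ
  have hbd : SmoothOnStrip J fun t x => 2 * (logDensityRate (R s₀) t x * r t x) +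
      2 * ((normalizedRate (R s₀) (T s₀) t x * R s₀ t x) * q t x) :=
    ((hw₀.mul hrs).const_mul 2).add (((hv₀.mul hρ).mul hqs).const_mul 2)
  have hgp : SmoothOnStrip J fun t x => geodesicDensity (R s₀) (T s₀) t x * r t x +
      2 * (momentumRate (R s₀) (T s₀) t x * q t x) :=
    ((smoothOnStrip_geodesicDensity hJ hρ hθ hpos₀).mul hrs).add
      (((smoothOnStrip_momentumRate hJ hρ hθ).mul hqs).const_mul 2)
  have hab : uIcc a b ⊆ J := hJ'.uIcc_subset ha hb
  -- the pointwise identity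
  have key : ∀ t ∈ J, ∀ x, deriv (fun s =>
      (logDensityRate (R s) t x ^ 2 + normalizedRate (R s) (T s) t x ^ 2) * R s t x) s₀ =
      partialTime (fun t x => 2 * (logDensityRate (R s₀) t x * r t x) +
        2 * ((normalizedRate (R s₀) (T s₀) t x * R s₀ t x) * q t x)) t x -
      (geodesicDensity (R s₀) (T s₀) t x * r t x +
        2 * (momentumRate (R s₀) (T s₀) t x * q t x)) -
      2 * deriv (fun s => meanRate (R s) (T s) t) s₀ *
        (normalizedRate (R s₀) (T s₀) t x * R s₀ t x) := by
    intro t ht x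
    have dR := hR.hasDerivAt_param hS hs₀ ht x
    have dRt := hRt.hasDerivAt_param hS hs₀ ht x
    have dTt := hTt.hasDerivAt_param hS hs₀ ht x
    have dm := hm.hasDerivAt_param hS hs₀ ht x
    rw [hR.deriv_param_comm hS hJ hs₀ ht] at dRt
    rw [hT.deriv_param_comm hS hJ hs₀ ht] at dTt
    have hne := (hpos₀ t ht x).ne'
    have d1 := ((((dRt.div dR hne).pow 2).add ((dTt.sub dm).pow 2)).mul dR).deriv
    have d2 := (((((hw₀.hasDerivAt_time hJ ht x).mul (hrs.hasDerivAt_time hJ ht x)).const_mul 2).add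
      (((((hv₀.mul hρ).hasDerivAt_time hJ ht x).mul
        (hqs.hasDerivAt_time hJ ht x)).const_mul 2)))).deriv
    refine d1.trans ?_
    rw [partialTime.eq_1 (fun t x => 2 * (logDensityRate (R s₀) t x * r t x) +
        2 * ((normalizedRate (R s₀) (T s₀) t x * R s₀ t x) * q t x))]
    refine Eq.trans ?_ (congrArg (fun z => z - _ - _) d2.symm)
    simp only [geodesicDensity, momentumRate, normalizedRate, logDensityRate, hr_def, hq_def,
      Pi.add_apply, Pi.sub_apply, Pi.div_apply, Pi.pow_apply, Nat.cast_ofNat, Nat.reduceSub,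
      pow_one]
    field_simp
    ring
  -- On integration the term with the variation of the mean drops out, because the normalized rate
  -- integrates to zero against the density.
  have hD : ∀ t ∈ J, deriv (fun s => ∫ x in (0 : ℝ)..1,
      (logDensityRate (R s) t x ^ 2 + normalizedRate (R s) (T s) t x ^ 2) * R s t x) s₀ =
      (∫ x in (0 : ℝ)..1, partialTime (fun t x => 2 * (logDensityRate (R s₀) t x * r t x) +
        2 * ((normalizedRate (R s₀) (T s₀) t x * R s₀ t x) * q t x)) t x) -
      geodesicPairing (R s₀) (T s₀) r q t := by
    intro t ht
    rw [((hF.time_slice ht).hasDerivAt_integral hS 0 1 hs₀).deriv]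
    refine (intervalIntegral.integral_congr fun x _ => key t ht x).trans ?_
    rw [intervalIntegral.integral_sub, intervalIntegral.integral_sub,
      intervalIntegral.integral_const_mul, integral_normalizedRate_mul hJ hρ hθ ht (hint t ht),
      geodesicPairing]
    · ring
    · exact (hbd.partialTime hJ).intervalIntegrable ht 0 1
    · exact hgp.intervalIntegrable ht 0 1
    · exact ((hbd.partialTime hJ).sub hgp).intervalIntegrable ht 0 1
    · exact ((hv₀.mul hρ).intervalIntegrable ht 0 1).const_mul _
  have hgpi : ContinuousOn (geodesicPairing (R s₀) (T s₀) r q) J :=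
    hgp.continuousOn_integral hJ 0 1
  have hE := hasDerivAt_intervalIntegral_param (f := fun s t => ∫ x in (0 : ℝ)..1,
    (logDensityRate (R s) t x ^ 2 + normalizedRate (R s) (T s) t x ^ 2) * R s t x) (hS.prod hJ)
    (ContDiffOn.of_le (hF.integral hS hJ 0 1) (by norm_cast)) (a := a) (b := b) (x₀ := s₀)
    fun t ht => ⟨hs₀, hab ht⟩
  rw [intervalIntegral.integral_congr (g := fun t => _) fun t ht => hD t (hab ht),
    intervalIntegral.integral_sub
      (((hbd.partialTime hJ).continuousOn_integral hJ 0 1).mono hab).intervalIntegrable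
      (hgpi.mono hab).intervalIntegrable,
    intervalIntegral.integral_eq_sub_of_hasDerivAt
      (fun t ht => hbd.hasDerivAt_integral hJ 0 1 (hab ht))
      (((hbd.partialTime hJ).continuousOn_integral hJ 0 1).mono hab).intervalIntegrable] at hE
  -- `1 / 8` combines the `1 / 2` of the energy with the `1 / 4` of the metric.
  refine (hE.const_mul (1 / 8)).congr_of_eventuallyEq (.of_forall fun s => ?_)
  simp only [sasakiEnergy, sasakiFisherRao, intervalIntegral.integral_const_mul]
  rw [← mul_assoc]
  norm_num
  rfl

/-! ### Points of `T^*Dens(S¹)` and their representatives -/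

namespace CotangentDens

variable {q q' : CotangentDens} {ρ ρ' θ θ' : ℝ → ℝ}

theorem Represents.contDiff_density (h : q.Represents ρ θ) : ContDiff ℝ ∞ ρ :=
  h.1 ▸ q.1.1.2.1

theorem Represents.periodic_density (h : q.Represents ρ θ) : Function.Periodic ρ 1 :=
  h.1 ▸ q.1.1.2.2

theorem Represents.pos (h : q.Represents ρ θ) (x : ℝ) : 0 < ρ x :=
  h.1 ▸ q.1.2.1 x

theorem Represents.integral_eq_one (h : q.Represents ρ θ) : ∫ x in (0 : ℝ)..1, ρ x = 1 :=
  h.1 ▸ q.1.2.2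

theorem Represents.contDiff_fibre (h : q.Represents ρ θ) : ContDiff ℝ ∞ θ := by
  obtain ⟨-, f, rfl, -⟩ := h
  exact f.2.1

theorem Represents.periodic_fibre (h : q.Represents ρ θ) : Function.Periodic θ 1 := by
  obtain ⟨-, f, rfl, -⟩ := h
  exact f.2.2

theorem exists_represents (hρ : ContDiff ℝ ∞ ρ) (hρp : Function.Periodic ρ 1)
    (hpos : ∀ x, 0 < ρ x) (hint : ∫ x in (0 : ℝ)..1, ρ x = 1) (hθ : ContDiff ℝ ∞ θ)
    (hθp : Function.Periodic θ 1) : ∃ q : CotangentDens, q.Represents ρ θ :=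
  ⟨(⟨⟨ρ, hρ, hρp⟩, hpos, hint⟩, Submodule.Quotient.mk ⟨θ, hθ, hθp⟩), rfl, ⟨θ, hθ, hθp⟩, rfl, rfl⟩

theorem exists_representative (q : CotangentDens) : ∃ ρ θ : ℝ → ℝ, q.Represents ρ θ := by
  obtain ⟨f, hf⟩ := Submodule.Quotient.mk_surjective _ q.2
  exact ⟨_, _, rfl, f, rfl, hf⟩

theorem Represents.density_eq (h : q.Represents ρ θ) (h' : q.Represents ρ' θ') : ρ = ρ' :=
  h.1.symm.trans h'.1

theorem Represents.exists_fibre_eq_add (h : q.Represents ρ θ) (h' : q.Represents ρ' θ') :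
    ∃ c, ∀ x, θ x = θ' x + c := by
  obtain ⟨-, f, rfl, hf⟩ := h
  obtain ⟨-, g, rfl, hg⟩ := h'
  obtain ⟨c, hc⟩ := (Submodule.Quotient.eq _).1 (hf.trans hg.symm)
  refine ⟨c, fun x => ?_⟩
  have : (f : ℝ → ℝ) x - (g : ℝ → ℝ) x = c := hc x
  linarith

theorem Represents.eq_of_fibre_eq_add (h : q.Represents ρ θ) (h' : q'.Represents ρ θ') {c : ℝ}
    (hc : ∀ x, θ x = θ' x + c) : q = q' := by
  obtain ⟨h1, f, rfl, hf⟩ := h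
  obtain ⟨h1', g, rfl, hg⟩ := h'
  refine Prod.ext (Subtype.ext (Subtype.ext (h1.trans h1'.symm))) ?_
  rw [← hf, ← hg]
  refine (Submodule.Quotient.eq _).2 ⟨c, fun x => ?_⟩
  change (f : ℝ → ℝ) x - (g : ℝ → ℝ) x = c
  rw [hc x]
  ring

theorem Represents.unique (h : q.Represents ρ θ) (h' : q'.Represents ρ θ) : q = q' :=
  h.eq_of_fibre_eq_add h' (c := 0) fun _ => (add_zero _).symm

end CotangentDens

/-! ### Independence of the fibre representative -/

section Congruence

variable {J : Set ℝ} {ρ ρ' θ θ' : ℝ → ℝ → ℝ} {k : ℝ → ℝ}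

theorem logDensityRate_congr (hJ : IsOpen J) (hρ : ∀ t ∈ J, ∀ x, ρ' t x = ρ t x) {t : ℝ}
    (ht : t ∈ J) (x : ℝ) : logDensityRate ρ' t x = logDensityRate ρ t x := by
  rw [logDensityRate, logDensityRate, hρ t ht,
    partialTime_congr hJ (fun s hs => hρ s hs x) ht]

/-- Adding `k(t)` to `θ` shifts both `θ̇` and its `ρ`-mean by `k'(t)`, as the mass is one. Hence the
geodesic equation depends only on the curve. -/
theorem normalizedRate_congr (hJ : IsOpen J) (hρs : SmoothOnStrip J ρ) (hθs : SmoothOnStrip J θ)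
    (hk : ContDiffOn ℝ ∞ k J)
    (hint : ∀ t ∈ J, ∫ x in (0 : ℝ)..1, ρ t x = 1) (hρ : ∀ t ∈ J, ∀ x, ρ' t x = ρ t x)
    (hθ : ∀ t ∈ J, ∀ x, θ' t x = θ t x + k t) {t : ℝ} (ht : t ∈ J) (x : ℝ) :
    normalizedRate ρ' θ' t x = normalizedRate ρ θ t x := by
  have hd : ∀ x, partialTime θ' t x = partialTime θ t x + deriv k t := fun x => by
    rw [partialTime_congr hJ (g := fun t x => θ t x + k t) (fun s hs => hθ s hs x) ht]
    exact ((hθs.hasDerivAt_time hJ ht x).add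
      ((hk.contDiffAt (hJ.mem_nhds ht)).differentiableAt (by simp)).hasDerivAt).deriv
  simp only [normalizedRate, meanRate, hd, hρ t ht, add_mul]
  rw [intervalIntegral.integral_add (((hθs.partialTime hJ).mul hρs).intervalIntegrable ht 0 1)
    ((hρs.intervalIntegrable ht 0 1).const_mul _), intervalIntegral.integral_const_mul, hint t ht]
  ring

theorem geodesicDensity_congr (hJ : IsOpen J) (hρs : SmoothOnStrip J ρ) (hθs : SmoothOnStrip J θ)
    (hk : ContDiffOn ℝ ∞ k J)
    (hint : ∀ t ∈ J, ∫ x in (0 : ℝ)..1, ρ t x = 1) (hρ : ∀ t ∈ J, ∀ x, ρ' t x = ρ t x)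
    (hθ : ∀ t ∈ J, ∀ x, θ' t x = θ t x + k t) {t : ℝ} (ht : t ∈ J) (x : ℝ) :
    geodesicDensity ρ' θ' t x = geodesicDensity ρ θ t x := by
  rw [geodesicDensity, geodesicDensity,
    normalizedRate_congr hJ hρs hθs hk hint hρ hθ ht, logDensityRate_congr hJ hρ ht,
    partialTime_congr hJ (fun s hs => logDensityRate_congr hJ hρ hs x) ht]

theorem momentumRate_congr (hJ : IsOpen J) (hρs : SmoothOnStrip J ρ) (hθs : SmoothOnStrip J θ)
    (hk : ContDiffOn ℝ ∞ k J)
    (hint : ∀ t ∈ J, ∫ x in (0 : ℝ)..1, ρ t x = 1) (hρ : ∀ t ∈ J, ∀ x, ρ' t x = ρ t x)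
    (hθ : ∀ t ∈ J, ∀ x, θ' t x = θ t x + k t) {t : ℝ} (ht : t ∈ J) (x : ℝ) :
    momentumRate ρ' θ' t x = momentumRate ρ θ t x :=
  partialTime_congr hJ (g := fun t x => normalizedRate ρ θ t x * ρ t x) (fun s hs => by
    rw [normalizedRate_congr hJ hρs hθs hk hint hρ hθ hs, hρ s hs]) ht

end Congruence

/-! ### The geodesic equation -/

/-- The geodesic equation of the Sasaki-Fisher-Rao metric. -/
def GeodesicEquation (J : Set ℝ) (ρ θ : ℝ → ℝ → ℝ) : Prop :=
  ∀ t ∈ J, (∃ c, ∀ x, geodesicDensity ρ θ t x = c) ∧ ∀ x, momentumRate ρ θ t x = 0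

/-- The pairing reduces to a constant times the integral of the density variation, which is zero
because the mass is fixed. The boundary terms vanish because the end points are fixed. -/
theorem IsSmoothRep.isSasakiGeodesic {J : Set ℝ} (hJ : IsOpen J) (hJ' : J.OrdConnected)
    {γ : ℝ → CotangentDens} {ρ θ : ℝ → ℝ → ℝ} (h : IsSmoothRep J γ ρ θ)
    (hEL : GeodesicEquation J ρ θ) : IsSasakiGeodesic J γ := by
  refine ⟨⟨ρ, θ, h⟩, fun a ha b hb _ ε hε Γ R T hfam hΓ₀ hΓ => ?_⟩
  obtain ⟨hρ, hθ, hrep⟩ := h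
  obtain ⟨hR, hT, hRT⟩ := hfam
  change SmoothOnStrip J ρ at hρ
  change SmoothOnStrip J θ at hθ
  change SmoothFamily _ J R at hR
  change SmoothFamily _ J T at hT
  have hS : IsOpen (Ioo (-ε) ε) := isOpen_Ioo
  have h0 : (0 : ℝ) ∈ Ioo (-ε) ε := ⟨by linarith, hε⟩
  have hR0 : ∀ t ∈ J, ∀ x, R 0 t x = ρ t x := fun t ht x => by
    have := hRT 0 h0 t ht
    rw [hΓ₀ t ht] at this
    exact congrFun (this.density_eq (hrep t ht)) x
  -- `T 0` and `θ` represent the same curve, so they differ by a function of time; evaluating at `x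
  -- = 0` shows that it is smooth.
  have hT0 : ∀ t ∈ J, ∀ x, T 0 t x = θ t x + (T 0 t 0 - θ t 0) := fun t ht x => by
    have := hRT 0 h0 t ht
    rw [hΓ₀ t ht] at this
    obtain ⟨c, hc⟩ := this.exists_fibre_eq_add (hrep t ht)
    rw [hc x, hc 0]
    ring
  have hk : ContDiffOn ℝ ∞ (fun t => T 0 t 0 - θ t 0) J :=
    ((hT.slice h0).time_slice 0).sub (hθ.time_slice 0)
  have hint : ∀ t ∈ J, ∫ x in (0 : ℝ)..1, ρ t x = 1 := fun t ht => (hrep t ht).integral_eq_one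
  have hintR : ∀ s ∈ Ioo (-ε) ε, ∀ t ∈ J, ∫ x in (0 : ℝ)..1, R s t x = 1 :=
    fun s hs t ht => (hRT s hs t ht).integral_eq_one
  have hvar := hasDerivAt_sasakiEnergy hS hJ hJ' hR hT
    (fun s hs t ht x => (hRT s hs t ht).pos x) h0 (hintR 0 h0) ha hb (fun t x => rfl)
    (fun t x => rfl)
  set r := fun t x => deriv (fun s => R s t x) 0
  set q := fun t x => deriv (fun s => T s t x) 0
  have hrs : SmoothOnStrip J r := hR.deriv_param hS hJ h0
  have hpair : ∀ t ∈ J, geodesicPairing (R 0) (T 0) r q t = 0 := by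
    intro t ht
    obtain ⟨⟨c, hc⟩, hP⟩ := hEL t ht
    have hr0 : ∫ x in (0 : ℝ)..1, r t x = 0 := by
      exact ((hR.time_slice ht).hasDerivAt_integral hS 0 1 h0).unique
        ((hasDerivAt_const (0 : ℝ) (1 : ℝ)).congr_of_eventuallyEq (by
          filter_upwards [hS.mem_nhds h0] with s hs using hintR s hs t ht))
    rw [geodesicPairing, intervalIntegral.integral_congr (g := fun x => c * r t x) fun x _ => by
      simp only [geodesicDensity_congr hJ hρ hθ hk hint hR0 hT0 ht,
        momentumRate_congr hJ hρ hθ hk hint hR0 hT0 ht, hc, hP]; ring,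
      intervalIntegral.integral_const_mul, hr0, mul_zero]
  have hbdry : ∀ t ∈ J, (∀ s ∈ Ioo (-ε) ε, Γ s t = γ t) →
      boundaryPairing (R 0) (T 0) r q t = 0 := by
    intro t ht hfix
    have hr0 : ∀ x, r t x = 0 := fun x => by
      refine (((hasDerivAt_const (0 : ℝ) (ρ t x)).congr_of_eventuallyEq ?_).deriv :)
      filter_upwards [hS.mem_nhds h0] with s hs
      have := hRT s hs t ht
      rw [hfix s hs] at this
      exact congrFun (this.density_eq (hrep t ht)) x
    -- A fixed end point fixes `T s t` only modulo constants, so `q t` is constant rather than zero;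
    -- orthogonality of the normalized rate to constants handles it.
    have hq0 : ∀ x, q t x = q t 0 := fun x => by
      have h1 : HasDerivAt (fun s => T s t 0 + (θ t x - θ t 0)) (q t 0) 0 :=
        (hT.hasDerivAt_param hS h0 ht 0).add_const _
      refine ((h1.congr_of_eventuallyEq ?_).deriv :)
      filter_upwards [hS.mem_nhds h0] with s hs
      have := hRT s hs t ht
      rw [hfix s hs] at this
      obtain ⟨c, hc⟩ := this.exists_fibre_eq_add (hrep t ht)
      rw [hc x, hc 0]
      ring
    rw [boundaryPairing, intervalIntegral.integral_congr (g := fun x => 2 * q t 0 *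
      (normalizedRate (R 0) (T 0) t x * R 0 t x)) fun x _ => by
        simp only [hr0, hq0 x]; ring,
      intervalIntegral.integral_const_mul,
      integral_normalizedRate_mul hJ (hR.slice h0) (hT.slice h0) ht (hintR 0 h0 t ht), mul_zero]
  rw [hbdry a ha fun s hs => (hΓ s hs).1, hbdry b hb fun s hs => (hΓ s hs).2,
    intervalIntegral.integral_congr (g := fun _ => 0)
      fun t ht => hpair t (hJ'.uIcc_subset ha hb ht)] at hvar
  simpa using hvar

theorem eqOn_zero_of_integral_eq_zero {f : ℝ → ℝ} {a b : ℝ} (hab : a < b)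
    (hf : ContinuousOn f (Icc a b)) (h0 : ∀ x ∈ Icc a b, 0 ≤ f x) (hint : ∫ x in a..b, f x = 0)
    {x : ℝ} (hx : x ∈ Icc a b) : f x = 0 := by
  by_contra hne
  exact (intervalIntegral.integral_pos hab hf (fun y hy => h0 y (Ioc_subset_Icc_self hy))
    ⟨x, hx, (h0 x hx).lt_of_ne' hne⟩).ne' hint

/-- Reweighting a curve of densities by `exp (s χ K)`, with the total mass normalized. -/
noncomputable def tiltedDensity (χ : ℝ → ℝ) (ρ K : ℝ → ℝ → ℝ) (s t x : ℝ) : ℝ :=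
  ρ t x * Real.exp (s * (χ t * K t x)) / ∫ y in (0 : ℝ)..1, ρ t y * Real.exp (s * (χ t * K t y))

section Tilted

variable {J : Set ℝ} {χ : ℝ → ℝ} {ρ K : ℝ → ℝ → ℝ}

theorem smoothFamily_tilted_numerator (hχ : ContDiff ℝ ∞ χ) (hρ : SmoothOnStrip J ρ)
    (hK : SmoothOnStrip J K) :
    SmoothFamily univ J fun s t x => ρ t x * Real.exp (s * (χ t * K t x)) :=
  (SmoothFamily.of_strip hρ).mul (SmoothFamily.of_param.mul
    (SmoothFamily.of_strip ((SmoothOnStrip.of_time hχ.contDiffOn).mul hK))).exp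

theorem tilted_mass_pos (hχ : ContDiff ℝ ∞ χ) (hρ : SmoothOnStrip J ρ)
    (hK : SmoothOnStrip J K) (hpos : ∀ t ∈ J, ∀ x, 0 < ρ t x) (s : ℝ) {t : ℝ} (ht : t ∈ J) :
    0 < ∫ y in (0 : ℝ)..1, ρ t y * Real.exp (s * (χ t * K t y)) :=
  intervalIntegral.intervalIntegral_pos_of_pos_on
    (((smoothFamily_tilted_numerator hχ hρ hK).slice (mem_univ s)).intervalIntegrable ht 0 1)
    (fun x _ => mul_pos (hpos t ht x) (Real.exp_pos _)) one_pos

theorem smoothFamily_tiltedDensity (hJ : IsOpen J) (hχ : ContDiff ℝ ∞ χ) (hρ : SmoothOnStrip J ρ)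
    (hK : SmoothOnStrip J K) (hpos : ∀ t ∈ J, ∀ x, 0 < ρ t x) :
    SmoothFamily univ J (tiltedDensity χ ρ K) :=
  (smoothFamily_tilted_numerator hχ hρ hK).div
    (.of_param_time ((smoothFamily_tilted_numerator hχ hρ hK).integral isOpen_univ hJ 0 1))
    fun s _ _ ht _ => (tilted_mass_pos hχ hρ hK hpos s ht).ne'

theorem tiltedDensity_pos (hχ : ContDiff ℝ ∞ χ) (hρ : SmoothOnStrip J ρ)
    (hK : SmoothOnStrip J K) (hpos : ∀ t ∈ J, ∀ x, 0 < ρ t x) (s : ℝ) {t : ℝ} (ht : t ∈ J)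
    (x : ℝ) : 0 < tiltedDensity χ ρ K s t x :=
  div_pos (mul_pos (hpos t ht x) (Real.exp_pos _)) (tilted_mass_pos hχ hρ hK hpos s ht)

theorem integral_tiltedDensity (hχ : ContDiff ℝ ∞ χ) (hρ : SmoothOnStrip J ρ)
    (hK : SmoothOnStrip J K) (hpos : ∀ t ∈ J, ∀ x, 0 < ρ t x) (s : ℝ) {t : ℝ} (ht : t ∈ J) :
    ∫ x in (0 : ℝ)..1, tiltedDensity χ ρ K s t x = 1 := by
  simp only [tiltedDensity]
  rw [intervalIntegral.integral_div]
  exact div_self (tilted_mass_pos hχ hρ hK hpos s ht).ne'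

theorem tiltedDensity_eq_self {s t : ℝ} (h : s * χ t = 0) (h1 : ∫ x in (0 : ℝ)..1, ρ t x = 1)
    (x : ℝ) : tiltedDensity χ ρ K s t x = ρ t x := by
  simp [tiltedDensity, ← mul_assoc, h, h1]

/-- At `s = 0` the normalizing mass is one, and differentiating it subtracts the `ρ`-mean of `K`. -/
theorem deriv_tiltedDensity (hχ : ContDiff ℝ ∞ χ) (hρ : SmoothOnStrip J ρ)
    (hK : SmoothOnStrip J K) {t : ℝ} (ht : t ∈ J) (h1 : ∫ x in (0 : ℝ)..1, ρ t x = 1) (x : ℝ) :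
    deriv (fun s => tiltedDensity χ ρ K s t x) 0 =
      χ t * (ρ t x * (K t x - ∫ y in (0 : ℝ)..1, ρ t y * K t y)) := by
  have hnum : ∀ x, HasDerivAt (fun s : ℝ => ρ t x * Real.exp (s * (χ t * K t x)))
      (χ t * (ρ t x * K t x)) 0 := fun x => by
    refine ((((hasDerivAt_id (0 : ℝ)).mul_const (χ t * K t x)).exp).const_mul (ρ t x)).congr_deriv ?_
    simp
    ring
  have hden := (((smoothFamily_tilted_numerator hχ hρ hK).time_slice ht).hasDerivAt_integral
    isOpen_univ 0 1 (mem_univ (0 : ℝ))).congr_deriv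
      ((intervalIntegral.integral_congr (g := fun x => χ t * (ρ t x * K t x))
        fun x _ => (hnum x).deriv).trans (intervalIntegral.integral_const_mul _ _))
  refine ((hnum x).div hden (by simp [h1])).deriv.trans ?_
  simp [h1]
  ring

end Tilted

/-- Test criticality with the variation pointing along the geodesic expressions themselves, cut off
in time by `χ`. With `k` the `ρ`-mean of `K`, the first variation is a negative multiple of `∫ χ ∫
(ρ (K - k)² + 2 P²)`, so its vanishing forces `K = k` and `P = 0`. Tilting by an exponential keeps
the densities positive for every `s`. -/
theorem IsSasakiGeodesic.geodesicEquation {J : Set ℝ} (hJ : IsOpen J) (hJ' : J.OrdConnected)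
    {γ : ℝ → CotangentDens} {ρ θ : ℝ → ℝ → ℝ} (h : IsSmoothRep J γ ρ θ)
    (hγ : IsSasakiGeodesic J γ) : GeodesicEquation J ρ θ := by
  obtain ⟨hρ, hθ, hrep⟩ := h
  change SmoothOnStrip J ρ at hρ
  change SmoothOnStrip J θ at hθ
  have hpos : ∀ t ∈ J, ∀ x, 0 < ρ t x := fun t ht => (hrep t ht).pos
  have hint : ∀ t ∈ J, ∫ x in (0 : ℝ)..1, ρ t x = 1 := fun t ht => (hrep t ht).integral_eq_one
  have hρp : ∀ t ∈ J, Function.Periodic (ρ t) 1 := fun t ht => (hrep t ht).periodic_density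
  have hθp : ∀ t ∈ J, Function.Periodic (θ t) 1 := fun t ht => (hrep t ht).periodic_fibre
  set K := geodesicDensity ρ θ with hK_def
  set P := momentumRate ρ θ with hP_def
  have hK : SmoothOnStrip J K := smoothOnStrip_geodesicDensity hJ hρ hθ hpos
  have hP : SmoothOnStrip J P := smoothOnStrip_momentumRate hJ hρ hθ
  have hwp : ∀ t ∈ J, Function.Periodic (logDensityRate ρ t) 1 := fun t ht x => by
    rw [logDensityRate, logDensityRate, periodic_partialTime hJ hρp t ht, hρp t ht]
  have hvp : ∀ t ∈ J, Function.Periodic (normalizedRate ρ θ t) 1 := fun t ht x => by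
    rw [normalizedRate, normalizedRate, periodic_partialTime hJ hθp t ht]
  have hKp : ∀ t ∈ J, Function.Periodic (K t) 1 := fun t ht x => by
    rw [hK_def, geodesicDensity, geodesicDensity, periodic_partialTime hJ hwp t ht, hwp t ht,
      hvp t ht]
  have hPp : ∀ t ∈ J, Function.Periodic (P t) 1 :=
    periodic_partialTime hJ fun t ht x => by rw [hvp t ht, hρp t ht]
  intro t₁ ht₁
  obtain ⟨a, b, hab, htab, -⟩ := exists_Ioo_mem hJ hJ' ht₁ ht₁
  have hlt : a < b := htab.1.trans htab.2
  have ha : a ∈ J := hab ⟨le_rfl, hlt.le⟩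
  have hb : b ∈ J := hab ⟨hlt.le, le_rfl⟩
  -- `χ` vanishes at both end points, which fixes them, and is positive at the interior point `t₁`.
  set χ : ℝ → ℝ := fun t => (t - a) * (b - t) with hχ_def
  have hχ : ContDiff ℝ ∞ χ := by fun_prop
  have hχa : χ a = 0 := by simp [χ]
  have hχb : χ b = 0 := by simp [χ]
  set R := tiltedDensity χ ρ K with hR_def
  set T : ℝ → ℝ → ℝ → ℝ := fun s t x => θ t x + s * (χ t * P t x) with hT_def
  have hR : SmoothFamily univ J R := smoothFamily_tiltedDensity hJ hχ hρ hK hpos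
  have hT : SmoothFamily univ J T := (SmoothFamily.of_strip hθ).add
    (SmoothFamily.of_param.mul (.of_strip ((SmoothOnStrip.of_time hχ.contDiffOn).mul hP)))
  have hex : ∀ s t, ∃ q : CotangentDens, t ∈ J → q.Represents (R s t) (T s t) := by
    intro s t
    by_cases ht : t ∈ J
    · obtain ⟨q, hq⟩ := CotangentDens.exists_represents
        ((hR.slice (mem_univ s)).space_slice ht)
        (fun x => by simp only [hR_def, tiltedDensity, hρp t ht x, hKp t ht x])
        (tiltedDensity_pos hχ hρ hK hpos s ht) (integral_tiltedDensity hχ hρ hK hpos s ht)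
        ((hT.slice (mem_univ s)).space_slice ht)
        (fun x => by simp only [hT_def, hθp t ht x, hPp t ht x])
      exact ⟨q, fun _ => hq⟩
    · exact ⟨γ t, fun h => absurd h ht⟩
  choose Γ hΓ using hex
  have hfix : ∀ s t, t ∈ J → s * χ t = 0 → Γ s t = γ t := fun s t ht hs => by
    have h1 := hΓ s t ht
    rw [show R s t = ρ t from funext (tiltedDensity_eq_self hs (hint t ht)),
      show T s t = θ t from funext fun x => by simp [hT_def, ← mul_assoc, hs]] at h1
    exact h1.unique (hrep t ht)
  have hcrit := hγ.2 a ha b hb hlt 1 one_pos Γ R T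
    ⟨ContDiffOn.mono hR (prod_mono (subset_univ _) le_rfl),
      ContDiffOn.mono hT (prod_mono (subset_univ _) le_rfl), fun s _ t ht => hΓ s t ht⟩
    (fun t ht => hfix 0 t ht (zero_mul _))
    (fun s _ => ⟨hfix s a ha (by rw [hχa, mul_zero]), hfix s b hb (by rw [hχb, mul_zero])⟩)
  have hvar := hasDerivAt_sasakiEnergy isOpen_univ hJ hJ' hR hT
    (fun s _ t ht => tiltedDensity_pos hχ hρ hK hpos s ht) (mem_univ 0)
    (fun t ht => integral_tiltedDensity hχ hρ hK hpos 0 ht) ha hb (fun t x => rfl) (fun t x => rfl)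
  set r := fun t x => deriv (fun s => R s t x) 0 with hr_def
  set q := fun t x => deriv (fun s => T s t x) 0 with hq_def
  set k : ℝ → ℝ := fun t => ∫ y in (0 : ℝ)..1, ρ t y * K t y with hk_def
  have hr : ∀ t ∈ J, ∀ x, r t x = χ t * (ρ t x * (K t x - k t)) := fun t ht x =>
    deriv_tiltedDensity hχ hρ hK ht (hint t ht) x
  have hq : ∀ t x, q t x = χ t * P t x := fun t x => by
    refine ((((hasDerivAt_id (0 : ℝ)).mul_const (χ t * P t x)).const_add (θ t x)).deriv).trans ?_
    ring
  have hbdry : ∀ t ∈ J, χ t = 0 → boundaryPairing (R 0) (T 0) r q t = 0 := fun t ht h0 => by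
    simp [boundaryPairing, hr t ht, hq t, h0]
  have hR0 : ∀ t ∈ J, ∀ x, R 0 t x = ρ t x := fun t ht =>
    tiltedDensity_eq_self (zero_mul _) (hint t ht)
  have hT0 : ∀ t ∈ J, ∀ x, T 0 t x = θ t x + 0 := fun t ht x => by simp [hT_def]
  set D : ℝ → ℝ → ℝ := fun t x => ρ t x * (K t x - k t) ^ 2 + 2 * P t x ^ 2 with hD_def
  have hk : ContDiffOn ℝ ∞ k J := (hρ.mul hK).integral hJ 0 1
  have hKk : SmoothOnStrip J fun t x => K t x - k t := hK.sub (.of_time hk)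
  have hD : SmoothOnStrip J D := (hρ.mul (hKk.pow 2)).add ((hP.pow 2).const_mul 2)
  have hD0 : ∀ t ∈ J, ∀ x, 0 ≤ D t x := fun t ht x => by
    have := hpos t ht x
    positivity
  have hpair : ∀ t ∈ J, geodesicPairing (R 0) (T 0) r q t =
      χ t * ∫ x in (0 : ℝ)..1, D t x := by
    intro t ht
    -- By the choice of `k`, the cross term in `K ρ (K - k) = ρ (K - k)² + k ρ (K - k)` integrates
    -- to zero.
    have hz : ∫ x in (0 : ℝ)..1, ρ t x * (K t x - k t) = 0 := by
      simp only [mul_sub]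
      rw [intervalIntegral.integral_sub ((hρ.mul hK).intervalIntegrable ht 0 1)
        ((hρ.intervalIntegrable ht 0 1).mul_const _), intervalIntegral.integral_mul_const,
        hint t ht, hk_def]
      ring
    rw [geodesicPairing, intervalIntegral.integral_congr
      (g := fun x => χ t * D t x + χ t * k t * (ρ t x * (K t x - k t))) fun x _ => by
        simp only [geodesicDensity_congr hJ hρ hθ contDiffOn_const hint hR0 hT0 ht,
          momentumRate_congr hJ hρ hθ contDiffOn_const hint hR0 hT0 ht, hr t ht, hq, hD_def,
          ← hK_def, ← hP_def]; ring,
      intervalIntegral.integral_add ((hD.intervalIntegrable ht 0 1).const_mul _)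
        (((hρ.mul hKk).intervalIntegrable ht 0 1).const_mul _),
      intervalIntegral.integral_const_mul, intervalIntegral.integral_const_mul, hz]
    ring
  have huIcc : uIcc a b ⊆ J := by rwa [uIcc_of_le hlt.le]
  rw [hbdry a ha hχa, hbdry b hb hχb,
    intervalIntegral.integral_congr fun t ht => hpair t (huIcc ht)] at hvar
  have hzero : ∫ t in a..b, χ t * ∫ x in (0 : ℝ)..1, D t x = 0 := by
    have := hvar.unique hcrit
    linarith
  have hDt : χ t₁ * ∫ x in (0 : ℝ)..1, D t₁ x = 0 := by
    refine eqOn_zero_of_integral_eq_zero hlt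
      (hχ.continuous.continuousOn.mul ((hD.continuousOn_integral hJ 0 1).mono hab))
      (fun t ht => mul_nonneg (mul_nonneg (by linarith [ht.1]) (by linarith [ht.2]))
        (intervalIntegral.integral_nonneg zero_le_one fun x _ => hD0 t (hab ht) x)) hzero
      (Ioo_subset_Icc_self htab)
  have hχt : χ t₁ ≠ 0 := (mul_pos (by linarith [htab.1]) (by linarith [htab.2])).ne'
  have hDx : ∀ x, D t₁ x = 0 := fun x => by
    obtain ⟨y, hy, hxy⟩ := Function.Periodic.exists_mem_Icc_eq (f := D t₁)
      (fun x => by simp only [hD_def, hρp t₁ ht₁ x, hKp t₁ ht₁ x, hPp t₁ ht₁ x]) x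
    rw [hxy]
    exact eqOn_zero_of_integral_eq_zero one_pos (hD.continuous_slice ht₁).continuousOn
      (fun x _ => hD0 t₁ ht₁ x) ((mul_eq_zero.1 hDt).resolve_left hχt) hy
  refine ⟨⟨k t₁, fun x => ?_⟩, fun x => ?_⟩
  · have h1 := hDx x
    have h2 := hpos t₁ ht₁ x
    have h3 : ρ t₁ x * (K t₁ x - k t₁) ^ 2 = 0 := by
      have : 0 ≤ ρ t₁ x * (K t₁ x - k t₁) ^ 2 := by positivity
      nlinarith [sq_nonneg (P t₁ x)]
    have h4 := pow_eq_zero_iff two_ne_zero |>.1 ((mul_eq_zero.1 h3).resolve_left h2.ne')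
    linarith
  · have h1 := hDx x
    have h2 := hpos t₁ ht₁ x
    have : 0 ≤ ρ t₁ x * (K t₁ x - k t₁) ^ 2 := by positivity
    have h3 : P t₁ x ^ 2 = 0 := by nlinarith [sq_nonneg (P t₁ x)]
    exact pow_eq_zero_iff two_ne_zero |>.1 h3

theorem IsSmoothRep.isSasakiGeodesic_iff {J : Set ℝ} (hJ : IsOpen J) (hJ' : J.OrdConnected)
    {γ : ℝ → CotangentDens} {ρ θ : ℝ → ℝ → ℝ} (h : IsSmoothRep J γ ρ θ) :
    IsSasakiGeodesic J γ ↔ GeodesicEquation J ρ θ :=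
  ⟨fun hγ => hγ.geodesicEquation hJ hJ' h, h.isSasakiGeodesic hJ hJ'⟩

/-! ### The two-component Hunter–Saxton system -/

theorem iteratedDeriv_two_eq (f : ℝ → ℝ) : iteratedDeriv 2 f = deriv (deriv f) := by
  rw [iteratedDeriv_succ, iteratedDeriv_one]

theorem iteratedDeriv_three_eq (f : ℝ → ℝ) : iteratedDeriv 3 f = deriv (deriv (deriv f)) := by
  rw [iteratedDeriv_succ, iteratedDeriv_two_eq]

theorem Function.Periodic.integral_shift {f : ℝ → ℝ} (hf : Function.Periodic f 1) (a : ℝ) :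
    ∫ x in a..a + 1, f x = ∫ x in (0 : ℝ)..1, f x := by
  simpa using hf.intervalIntegral_add_eq a 0

/-- Twice the `x`-primitive of the first equation of the two-component Hunter-Saxton system. -/
noncomputable def hunterSaxtonPotential (u σ : ℝ → ℝ → ℝ) (t x : ℝ) : ℝ :=
  2 * (partialTime (partialSpace u) t x + partialSpace (partialSpace u) t x * u t x) +
    partialSpace u t x ^ 2 - σ t x ^ 2

section Potential

variable {J : Set ℝ} {u σ : ℝ → ℝ → ℝ}

theorem smoothOnStrip_hunterSaxtonPotential (hJ : IsOpen J) (hu : SmoothOnStrip J u)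
    (hσ : SmoothOnStrip J σ) : SmoothOnStrip J (hunterSaxtonPotential u σ) :=
  (((((hu.partialSpace hJ).partialTime hJ).add
    (((hu.partialSpace hJ).partialSpace hJ).mul hu)).const_mul 2).add
    ((hu.partialSpace hJ).pow 2)).sub (hσ.pow 2)

/-- With `∂ₓ∂ₜ u_x = ∂ₜ u_xx` this is a computation. It turns the first equation into the statement
that the potential is constant in `x`, the form in which geodesics produce it. -/
theorem partialSpace_hunterSaxtonPotential (hJ : IsOpen J) (hu : SmoothOnStrip J u)
    (hσ : SmoothOnStrip J σ) {t : ℝ} (ht : t ∈ J) (x : ℝ) :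
    partialSpace (hunterSaxtonPotential u σ) t x =
      2 * (deriv (fun s => iteratedDeriv 2 (u s) x) t -
        (-2 * deriv (u t) x * iteratedDeriv 2 (u t) x - u t x * iteratedDeriv 3 (u t) x +
          σ t x * deriv (σ t) x)) := by
  have hux := hu.partialSpace hJ
  have huxx := hux.partialSpace hJ
  have h := (((((hux.partialTime hJ).hasDerivAt_space hJ ht x).add
    ((huxx.hasDerivAt_space hJ ht x).mul (hu.hasDerivAt_space hJ ht x))).const_mul 2).add
    ((hux.hasDerivAt_space hJ ht x).pow 2)).sub ((hσ.hasDerivAt_space hJ ht x).pow 2)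
  rw [← hux.partial_comm hJ ht] at h
  refine h.deriv.trans ?_
  simp only [iteratedDeriv_two_eq, iteratedDeriv_three_eq]
  change _ = 2 * (partialTime (partialSpace (partialSpace u)) t x -
    (-2 * partialSpace u t x * partialSpace (partialSpace u) t x -
      u t x * partialSpace (partialSpace (partialSpace u)) t x + σ t x * partialSpace σ t x))
  simp only [Nat.cast_ofNat, Nat.reduceSub, pow_one]
  ring

/-- The second equation is a conservation law: `(σu)_x` integrates to zero over a period. -/
theorem integral_sigma_eq (hJ : IsOpen J) (hJ' : J.OrdConnected) (h : IsTwoHSSolution J u σ)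
    {s t : ℝ} (hs : s ∈ J) (ht : t ∈ J) :
    ∫ x in (0 : ℝ)..1, σ s x = ∫ x in (0 : ℝ)..1, σ t x := by
  have hu : SmoothOnStrip J u := h.smooth_u
  have hσ : SmoothOnStrip J σ := h.smooth_sigma
  refine eq_of_hasDerivAt_zero hJ hJ' (f := fun t => ∫ x in (0 : ℝ)..1, σ t x) (fun t ht => ?_) hs ht
  refine (hσ.hasDerivAt_integral hJ 0 1 ht).congr_deriv ?_
  have hp := hσ.mul hu
  refine (intervalIntegral.integral_congr
    (g := fun x => -partialSpace (fun t y => σ t y * u t y) t x)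
    fun x _ => h.eq_sigma t ht x).trans ?_
  rw [intervalIntegral.integral_neg,
    intervalIntegral.integral_eq_sub_of_hasDerivAt (fun x _ => hp.hasDerivAt_space hJ ht x)
      ((hp.partialSpace hJ).intervalIntegrable ht 0 1)]
  have h1 := h.periodic_u t ht 0
  have h2 := h.periodic_sigma t ht 0
  rw [zero_add] at h1 h2
  rw [h1, h2]
  ring

end Potential

/-! ### Geodesic expressions along a motion -/

namespace IsMotion

variable {J : Set ℝ} {φ α u σ : ℝ → ℝ → ℝ}

theorem smoothOnStrip_phi (h : IsMotion J φ α u σ) : SmoothOnStrip J φ := h.smooth_phi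

theorem smoothOnStrip_alpha (h : IsMotion J φ α u σ) : SmoothOnStrip J α := h.smooth_alpha

theorem partialTime_phi (h : IsMotion J φ α u σ) {t : ℝ} (ht : t ∈ J) (x : ℝ) :
    partialTime φ t x = u t (φ t x) := h.velocity_phi t ht x

theorem partialTime_alpha (h : IsMotion J φ α u σ) {t : ℝ} (ht : t ∈ J) (x : ℝ) :
    partialTime α t x = σ t (φ t x) := h.velocity_alpha t ht x

theorem partialSpace_pos (h : IsMotion J φ α u σ) {t : ℝ} (ht : t ∈ J) (x : ℝ) :
    0 < partialSpace φ t x := h.deriv_phi_pos t ht x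

theorem surjective (h : IsMotion J φ α u σ) {t : ℝ} (ht : t ∈ J) : Function.Surjective (φ t) :=
  surjective_of_add_one (h.smoothOnStrip_phi.continuous_slice ht) (h.equivariant_phi t ht)

/-- Smoothness of the fields is not part of `IsMotion`; it follows from `u = φ̇ ∘ φ⁻¹`, `σ = α̇ ∘
φ⁻¹` and the smooth curve of inverses. -/
theorem smoothOnStrip_velocity (hJ : IsOpen J) (h : IsMotion J φ α u σ) :
    SmoothOnStrip J u ∧ SmoothOnStrip J σ := by
  obtain ⟨ψ, hψ, hinv⟩ := h.smoothOnStrip_phi.exists_inverse hJ h.equivariant_phi h.deriv_phi_pos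
  refine ⟨((h.smoothOnStrip_phi.partialTime hJ).comp hψ).congr fun t ht x => ?_,
    ((h.smoothOnStrip_alpha.partialTime hJ).comp hψ).congr fun t ht x => ?_⟩
  · rw [h.partialTime_phi ht, (hinv t ht x).1]
  · rw [h.partialTime_alpha ht, (hinv t ht x).1]

theorem periodic_velocity (hJ : IsOpen J) (h : IsMotion J φ α u σ) {t : ℝ} (ht : t ∈ J) :
    Function.Periodic (u t) 1 ∧ Function.Periodic (σ t) 1 := by
  constructor
  · intro y
    obtain ⟨x, rfl⟩ := h.surjective ht y
    rw [← h.equivariant_phi t ht, ← h.partialTime_phi ht, ← h.partialTime_phi ht,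
      partialTime_congr hJ (g := fun t x => φ t x + 1) (fun s hs => h.equivariant_phi s hs x) ht]
    exact deriv_add_const _
  · intro y
    obtain ⟨x, rfl⟩ := h.surjective ht y
    rw [← h.equivariant_phi t ht, ← h.partialTime_alpha ht, ← h.partialTime_alpha ht,
      periodic_partialTime hJ h.periodic_alpha t ht]

theorem isSmoothRep (hJ : IsOpen J) (h : IsMotion J φ α u σ) {γ : ℝ → CotangentDens}
    (hγ : LiesOver J φ α γ) : IsSmoothRep J γ (partialSpace φ) α :=
  ⟨h.smoothOnStrip_phi.partialSpace hJ, h.smooth_alpha, hγ⟩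

/-- Change of variables `y = φ(x)`, which maps a period onto a period. -/
theorem meanRate_eq (hJ : IsOpen J) (h : IsMotion J φ α u σ) {t : ℝ} (ht : t ∈ J) :
    meanRate (partialSpace φ) α t = ∫ x in (0 : ℝ)..1, σ t x := by
  have hσ := (h.smoothOnStrip_velocity hJ).2
  have hφ := h.smoothOnStrip_phi
  rw [meanRate, ← (h.periodic_velocity hJ ht).2.integral_shift (φ t 0),
    ← h.equivariant_phi t ht 0, zero_add]
  simp only [h.partialTime_alpha ht]
  exact intervalIntegral.integral_comp_mul_deriv (fun x _ => hφ.hasDerivAt_space hJ ht x)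
    ((hφ.partialSpace hJ).continuous_slice ht).continuousOn (hσ.continuous_slice ht)

/-- Differentiating `φ̇ = u ∘ φ` in `x` gives `∂ₜ φ_x = (u_x ∘ φ) φ_x`. -/
theorem logDensityRate_eq (hJ : IsOpen J) (h : IsMotion J φ α u σ) {t : ℝ} (ht : t ∈ J) (x : ℝ) :
    logDensityRate (partialSpace φ) t x = partialSpace u t (φ t x) := by
  have hu := (h.smoothOnStrip_velocity hJ).1
  have hφ := h.smoothOnStrip_phi
  rw [logDensityRate, hφ.partial_comm hJ ht, div_eq_iff (h.partialSpace_pos ht x).ne',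
    ← hu.partialSpace_comp hJ hφ ht]
  exact congrArg (fun f => deriv f x) (funext fun y => h.partialTime_phi ht y)

theorem normalizedRate_eq (hJ : IsOpen J) (h : IsMotion J φ α u σ) {t : ℝ} (ht : t ∈ J)
    (h0 : ∫ x in (0 : ℝ)..1, σ t x = 0) (x : ℝ) :
    normalizedRate (partialSpace φ) α t x = σ t (φ t x) := by
  rw [normalizedRate, h.meanRate_eq hJ ht, h0, sub_zero, h.partialTime_alpha ht]

theorem geodesicDensity_eq (hJ : IsOpen J) (h : IsMotion J φ α u σ) {t : ℝ} (ht : t ∈ J)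
    (h0 : ∫ x in (0 : ℝ)..1, σ t x = 0) (x : ℝ) :
    geodesicDensity (partialSpace φ) α t x = hunterSaxtonPotential u σ t (φ t x) := by
  have hu := (h.smoothOnStrip_velocity hJ).1
  rw [geodesicDensity, h.normalizedRate_eq hJ ht h0, h.logDensityRate_eq hJ ht,
    partialTime_congr hJ (g := fun t x => partialSpace u t (φ t x))
      (fun s hs => h.logDensityRate_eq hJ hs x) ht,
    (hu.partialSpace hJ).partialTime_comp hJ h.smoothOnStrip_phi ht, h.partialTime_phi ht,
    hunterSaxtonPotential]

/-- The momentum `(σ ∘ φ) φ_x` is the pullback of the density `σ dx`, so its time derivative is the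
pullback of the continuity expression. -/
theorem momentumRate_eq (hJ : IsOpen J) (h : IsMotion J φ α u σ)
    (h0 : ∀ t ∈ J, ∫ x in (0 : ℝ)..1, σ t x = 0) {t : ℝ} (ht : t ∈ J) (x : ℝ) :
    momentumRate (partialSpace φ) α t x =
      (partialTime σ t (φ t x) + partialSpace (fun t y => σ t y * u t y) t (φ t x)) *
        partialSpace φ t x := by
  obtain ⟨hu, hσ⟩ := h.smoothOnStrip_velocity hJ
  have hφ := h.smoothOnStrip_phi
  rw [momentumRate, partialTime_congr hJ (g := fun t x => σ t (φ t x) * partialSpace φ t x)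
    (fun s hs => by rw [h.normalizedRate_eq hJ hs (h0 s hs)]) ht]
  have h1 := ((hσ.comp hφ).hasDerivAt_time hJ ht x).mul ((hφ.partialSpace hJ).hasDerivAt_time hJ ht x)
  have h2 := (hσ.hasDerivAt_space hJ ht (φ t x)).mul (hu.hasDerivAt_space hJ ht (φ t x))
  have h3 := h.logDensityRate_eq hJ ht x
  rw [logDensityRate, div_eq_iff (h.partialSpace_pos ht x).ne'] at h3
  refine h1.deriv.trans ?_
  rw [h3, hσ.partialTime_comp hJ hφ ht, h.partialTime_phi ht]
  refine Eq.trans ?_ (congrArg (fun z => (_ + z) * _) h2.deriv.symm)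
  ring

/-- Surjectivity of `φ t` passes from identities at `φ t x` to identities at all points, and `φ_x >
0` can be cancelled. -/
theorem geodesicEquation_iff (hJ : IsOpen J) (h : IsMotion J φ α u σ)
    (h0 : ∀ t ∈ J, ∫ x in (0 : ℝ)..1, σ t x = 0) :
    GeodesicEquation J (partialSpace φ) α ↔ IsTwoHSSolution J u σ := by
  obtain ⟨hu, hσ⟩ := h.smoothOnStrip_velocity hJ
  have hH := smoothOnStrip_hunterSaxtonPotential hJ hu hσ
  constructor
  · intro hG
    refine ⟨hu, hσ, fun t ht => (h.periodic_velocity hJ ht).1,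
      fun t ht => (h.periodic_velocity hJ ht).2, fun t ht x => ?_, fun t ht y => ?_⟩
    · obtain ⟨c, hc⟩ := (hG t ht).1
      have hcst : hunterSaxtonPotential u σ t = fun _ => c := funext fun y => by
        obtain ⟨x, rfl⟩ := h.surjective ht y
        rw [← h.geodesicDensity_eq hJ ht (h0 t ht), hc]
      have := partialSpace_hunterSaxtonPotential hJ hu hσ ht x
      rw [partialSpace, hcst, deriv_const] at this
      linarith
    · obtain ⟨x, rfl⟩ := h.surjective ht y
      have := (hG t ht).2 x
      rw [h.momentumRate_eq hJ h0 ht] at this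
      have := (mul_eq_zero.1 this).resolve_right (h.partialSpace_pos ht x).ne'
      exact eq_neg_of_add_eq_zero_left this
  · intro hS t ht
    refine ⟨⟨hunterSaxtonPotential u σ t 0, fun x => ?_⟩, fun x => ?_⟩
    · rw [h.geodesicDensity_eq hJ ht (h0 t ht)]
      refine is_const_of_deriv_eq_zero
        (fun x => (hH.hasDerivAt_space hJ ht x).differentiableAt) (fun x => ?_) _ _
      refine (partialSpace_hunterSaxtonPotential hJ hu hσ ht x).trans ?_
      rw [hS.eq_u t ht x]
      ring
    · rw [h.momentumRate_eq hJ h0 ht]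
      have : partialTime σ t (φ t x) = -partialSpace (fun t y => σ t y * u t y) t (φ t x) :=
        hS.eq_sigma t ht (φ t x)
      rw [this]
      ring

theorem isTwoHSSolution_iff (hJ : IsOpen J) (hJ' : J.OrdConnected) {t₀ : ℝ} (ht₀ : t₀ ∈ J)
    (h : IsMotion J φ α u σ) {γ : ℝ → CotangentDens} (hγ : LiesOver J φ α γ) :
    (IsTwoHSSolution J u σ ∧ ∫ x in (0 : ℝ)..1, σ t₀ x = 0) ↔
      (IsSasakiGeodesic J γ ∧ ∀ t ∈ J, ∫ x in (0 : ℝ)..1, σ t x = 0) := by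
  rw [(h.isSmoothRep hJ hγ).isSasakiGeodesic_iff hJ hJ']
  constructor
  · rintro ⟨hS, h0⟩
    have hall : ∀ t ∈ J, ∫ x in (0 : ℝ)..1, σ t x = 0 := fun t ht =>
      (integral_sigma_eq hJ hJ' hS ht ht₀).trans h0
    exact ⟨(h.geodesicEquation_iff hJ hall).2 hS, hall⟩
  · rintro ⟨hG, hall⟩
    exact ⟨(h.geodesicEquation_iff hJ hall).1 hG, hall t₀ ht₀⟩

end IsMotion

/-! ### Uniqueness of curves and of velocities -/

theorem eq_of_deriv_eq_of_eq {f g : ℝ → ℝ} (hf : Differentiable ℝ f) (hg : Differentiable ℝ g)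
    (h : deriv f = deriv g) {a : ℝ} (ha : f a = g a) : f = g := by
  funext x
  have := is_const_of_deriv_eq_zero (hf.sub hg) (fun y => by
    rw [deriv_sub (hf y) (hg y), h, sub_self]) x a
  simp only [Pi.sub_apply, ha, sub_self] at this
  linarith

theorem Function.Periodic.primitive_add_one {f : ℝ → ℝ} (hf : Function.Periodic f 1)
    (hc : Continuous f) (h1 : ∫ x in (0 : ℝ)..1, f x = 1) (x : ℝ) :
    ∫ y in (0 : ℝ)..x + 1, f y = (∫ y in (0 : ℝ)..x, f y) + 1 := by
  rw [← intervalIntegral.integral_add_adjacent_intervals (hc.intervalIntegrable 0 x)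
    (hc.intervalIntegrable x (x + 1)), hf.integral_shift, h1]

namespace IsMotion

variable {J : Set ℝ} {φ α φ' α' u σ u' σ' : ℝ → ℝ → ℝ} {t₀ : ℝ}

theorem isTrajectory (hJ : IsOpen J) (h : IsMotion J φ α u σ) (x : ℝ) :
    IsTrajectory J u fun t => φ t x := fun t ht => by
  rw [← h.partialTime_phi ht]
  exact h.smoothOnStrip_phi.hasDerivAt_time hJ ht x

theorem differentiable_phi (hJ : IsOpen J) (h : IsMotion J φ α u σ) {t : ℝ} (ht : t ∈ J) :
    Differentiable ℝ (φ t) :=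
  fun x => (h.smoothOnStrip_phi.hasDerivAt_space hJ ht x).differentiableAt

/-- The velocity determines the curve in `T^*Dens(S¹)` from its initial point. -/
theorem liesOver_unique (hJ : IsOpen J) (hJ' : J.OrdConnected) (ht₀ : t₀ ∈ J)
    (h : IsMotion J φ α u σ) (h' : IsMotion J φ' α' u σ) (h0 : φ t₀ 0 = φ' t₀ 0)
    {γ γ' : ℝ → CotangentDens} (hγ : LiesOver J φ α γ) (hγ' : LiesOver J φ' α' γ')
    (heq : γ' t₀ = γ t₀) {t : ℝ} (ht : t ∈ J) : γ' t = γ t := by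
  have hrep := hγ' t₀ ht₀
  rw [heq] at hrep
  have hu := (h.smoothOnStrip_velocity hJ).1
  -- The density fixes the derivative of the diffeomorphism and the base point condition fixes the
  -- remaining rotation.
  have hφ₀ : φ' t₀ = φ t₀ := eq_of_deriv_eq_of_eq (h'.differentiable_phi hJ ht₀)
    (h.differentiable_phi hJ ht₀) (hrep.density_eq (hγ t₀ ht₀)) h0.symm
  have hφ : ∀ t ∈ J, ∀ x, φ' t x = φ t x := fun t ht x =>
    (h'.isTrajectory hJ x).unique hJ hJ' hu (h.isTrajectory hJ x) ht₀ (congrFun hφ₀ x) ht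
  obtain ⟨c, hc⟩ := hrep.exists_fibre_eq_add (hγ t₀ ht₀)
  have hα : ∀ x, α' t x = α t x + c := fun x => by
    have := eq_of_hasDerivAt_zero hJ hJ' (f := fun t => α' t x - α t x) (fun t ht => by
      refine ((h'.smoothOnStrip_alpha.hasDerivAt_time hJ ht x).sub
        (h.smoothOnStrip_alpha.hasDerivAt_time hJ ht x)).congr_deriv ?_
      rw [h.partialTime_alpha ht, h'.partialTime_alpha ht, hφ t ht, sub_self]) ht ht₀
    rw [hc x] at this
    linarith
  have h1 := hγ' t ht
  rw [show φ' t = φ t from funext (hφ t ht)] at h1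
  exact h1.eq_of_fibre_eq_add (hγ t ht) hα

/-- The velocity is determined by the curve in `T^*Dens(S¹)`, if it vanishes at the base point
and has zero mean. -/
theorem velocity_unique (hJ : IsOpen J) (hJ' : J.OrdConnected) (ht₀ : t₀ ∈ J)
    (h : IsMotion J φ α u σ) (h' : IsMotion J φ' α' u' σ')
    (hu0 : ∀ t ∈ J, u t 0 = 0) (hu0' : ∀ t ∈ J, u' t 0 = 0)
    (hσ0 : ∀ t ∈ J, ∫ x in (0 : ℝ)..1, σ t x = 0) (hσ0' : ∀ t ∈ J, ∫ x in (0 : ℝ)..1, σ' t x = 0)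
    (h0 : φ t₀ 0 = 0) (h0' : φ' t₀ 0 = 0) {γ : ℝ → CotangentDens} (hγ : LiesOver J φ α γ)
    (hγ' : LiesOver J φ' α' γ) {t : ℝ} (ht : t ∈ J) (x : ℝ) :
    u' t x = u t x ∧ σ' t x = σ t x := by
  -- As `u t 0 = 0`, the constant curve `0` is a trajectory, so `φ t` fixes the base point at all
  -- times.
  have hbase : ∀ {φ α u σ : ℝ → ℝ → ℝ}, IsMotion J φ α u σ → (∀ t ∈ J, u t 0 = 0) →
      φ t₀ 0 = 0 → ∀ t ∈ J, φ t 0 = 0 := fun {φ α u σ} h hu0 h0 t ht =>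
    (h.isTrajectory hJ 0).unique hJ hJ' (h.smoothOnStrip_velocity hJ).1 (Y := fun _ => 0)
      (fun s hs => by rw [hu0 s hs]; exact hasDerivAt_const _ _) ht₀ h0 ht
  have hφ : ∀ t ∈ J, ∀ x, φ' t x = φ t x := fun t ht => congrFun <|
    eq_of_deriv_eq_of_eq (h'.differentiable_phi hJ ht) (h.differentiable_phi hJ ht)
      ((hγ' t ht).density_eq (hγ t ht)) (a := 0)
      ((hbase h' hu0' h0' t ht).trans (hbase h hu0 h0 t ht).symm)
  have hα : ∀ t ∈ J, ∀ x, α' t x = α t x + (α' t 0 - α t 0) := fun t ht x => by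
    obtain ⟨c, hc⟩ := (hγ' t ht).exists_fibre_eq_add (hγ t ht)
    rw [hc x, hc 0]
    ring
  obtain ⟨y, rfl⟩ := h.surjective ht x
  constructor
  · rw [← h.partialTime_phi ht, ← hφ t ht, ← h'.partialTime_phi ht]
    exact partialTime_congr hJ (fun s hs => hφ s hs y) ht
  -- `α'` and `α` may differ by a function of time, but `σ ∘ φ` is the normalized rate, which does
  -- not see it.
  · rw [← h.normalizedRate_eq hJ ht (hσ0 t ht), ← hφ t ht,
      ← h'.normalizedRate_eq hJ ht (hσ0' t ht)]
    exact normalizedRate_congr hJ (h.smoothOnStrip_phi.partialSpace hJ) h.smoothOnStrip_alpha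
      ((h'.smoothOnStrip_alpha.time_slice 0).sub (h.smoothOnStrip_alpha.time_slice 0))
      (fun t ht => (hγ t ht).integral_eq_one)
      (fun t ht x => congrFun ((hγ' t ht).density_eq (hγ t ht)) x) hα ht y

end IsMotion

/-! ### Existence of motions -/

/-- A motion of the circle with a given velocity and initial point. -/
theorem exists_isMotion {J : Set ℝ} (hJ : IsOpen J) (hJ' : J.OrdConnected) {t₀ : ℝ} (ht₀ : t₀ ∈ J)
    {u σ : ℝ → ℝ → ℝ} (hu : SmoothOnStrip J u) (hσ : SmoothOnStrip J σ)
    (hup : ∀ t ∈ J, Function.Periodic (u t) 1) (hσp : ∀ t ∈ J, Function.Periodic (σ t) 1)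
    {ρ θ : ℝ → ℝ} (hρ : ContDiff ℝ ∞ ρ) (hρp : Function.Periodic ρ 1) (hpos : ∀ x, 0 < ρ x)
    (hint : ∫ x in (0 : ℝ)..1, ρ x = 1) (hθ : ContDiff ℝ ∞ θ) (hθp : Function.Periodic θ 1) :
    ∃ φ α : ℝ → ℝ → ℝ, IsMotion J φ α u σ ∧ φ t₀ 0 = 0 ∧ deriv (φ t₀) = ρ ∧ α t₀ = θ := by
  obtain ⟨X, hX⟩ := exists_flow hJ hJ' hu hup ht₀
  have hXs := hX.smoothOnStrip hJ hJ' hu hup ht₀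
  -- The primitive of `ρ` is the initial diffeomorphism; composing the flow after it leaves the
  -- velocity field unchanged.
  set φ₀ : ℝ → ℝ := fun x => ∫ y in (0 : ℝ)..x, ρ y with hφ₀
  have hφ₀s : SmoothOnStrip J fun _ x => φ₀ x :=
    (SmoothOnStrip.of_space hρ).primitive_space hJ
  have hφ₀d : ∀ x, HasDerivAt φ₀ (ρ x) x := fun x =>
    hρ.continuous.integral_hasStrictDerivAt 0 x |>.hasDerivAt
  set φ : ℝ → ℝ → ℝ := fun t x => X t (φ₀ x) with hφ
  have hφs : SmoothOnStrip J φ := hXs.comp hφ₀s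
  have hφ1 : ∀ t ∈ J, ∀ x, φ t (x + 1) = φ t x + 1 := fun t ht x => by
    simp only [hφ, hφ₀]
    rw [hρp.primitive_add_one hρ.continuous hint, hX.add_one hJ hJ' hu hup ht₀ ht]
  have hσφ : SmoothOnStrip J fun t x => σ t (φ t x) := hσ.comp hφs
  refine ⟨φ, fun t x => θ x + ∫ s in t₀..t, σ s (φ s x), ⟨hφs, ?_, hφ1, ?_, ?_, ?_, ?_⟩, ?_, ?_, ?_⟩
  · exact (SmoothOnStrip.of_space hθ).add (hσφ.primitive_time hJ hJ' ht₀)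
  · intro t ht x
    have := ((hXs.hasDerivAt_space hJ ht (φ₀ x)).comp x (hφ₀d x)).deriv
    exact (mul_pos (hX.partialSpace_pos hJ hJ' hu hup ht₀ ht _) (hpos x)).trans_eq this.symm
  · intro t ht x
    simp only [hθp x]
    refine congrArg (θ x + ·) (intervalIntegral.integral_congr fun s hs => ?_)
    have hsJ := hJ'.uIcc_subset ht₀ ht hs
    simp only [hφ1 s hsJ x, hσp s hsJ (φ s x)]
  · exact fun t ht x => (hX.trajectory (φ₀ x) t ht).deriv
  · exact fun t ht x =>
      ((hasDerivAt_primitive hJ hJ' (hσφ.time_slice x).continuousOn ht₀ ht).const_add _).deriv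
  · simp [hφ, hφ₀, hX.initial]
  · funext x
    simp only [hφ, hX.initial]
    exact (hφ₀d x).deriv
  · funext x
    simp

theorem IsMotion.exists_liesOver {J : Set ℝ} (hJ : IsOpen J) {φ α u σ : ℝ → ℝ → ℝ}
    (h : IsMotion J φ α u σ) {t₀ : ℝ} (ht₀ : t₀ ∈ J) :
    ∃ γ : ℝ → CotangentDens, LiesOver J φ α γ := by
  have hex : ∀ t ∈ J, ∃ q : CotangentDens, q.Represents (deriv (φ t)) (α t) := by
    intro t ht
    have hφ := h.smoothOnStrip_phi
    refine CotangentDens.exists_represents ((hφ.partialSpace hJ).space_slice ht) (fun x => ?_)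
      (h.deriv_phi_pos t ht) ?_ (h.smoothOnStrip_alpha.space_slice ht) (h.periodic_alpha t ht)
    · rw [← deriv_comp_add_const, show (fun x => φ t (x + 1)) = fun x => φ t x + 1 from
        funext (h.equivariant_phi t ht), deriv_add_const]
    · have := h.equivariant_phi t ht 0
      rw [zero_add] at this
      refine (intervalIntegral.integral_eq_sub_of_hasDerivAt
        (fun x _ => hφ.hasDerivAt_space hJ ht x)
        ((hφ.partialSpace hJ).intervalIntegrable ht 0 1)).trans ?_
      linarith
  have : Nonempty CotangentDens := (hex t₀ ht₀).nonempty
  choose! γ hγ using hex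
  exact ⟨γ, hγ⟩

theorem exists_geodesic_of_isTwoHSSolution {J : Set ℝ} (hJ : IsOpen J) (hJ' : J.OrdConnected)
    {t₀ : ℝ} (ht₀ : t₀ ∈ J) {u σ : ℝ → ℝ → ℝ} (h : IsTwoHSSolution J u σ)
    (h0 : ∫ x in (0 : ℝ)..1, σ t₀ x = 0) (q : CotangentDens) :
    ∃ γ : ℝ → CotangentDens, IsSasakiGeodesic J γ ∧ γ t₀ = q ∧ Generates J t₀ u σ γ := by
  obtain ⟨ρ, θ, hq⟩ := q.exists_representative
  obtain ⟨φ, α, hm, hφ0, hρ, hθ⟩ := exists_isMotion hJ hJ' ht₀ h.smooth_u h.smooth_sigma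
    h.periodic_u h.periodic_sigma hq.contDiff_density hq.periodic_density hq.pos
    hq.integral_eq_one hq.contDiff_fibre hq.periodic_fibre
  obtain ⟨γ, hγ⟩ := hm.exists_liesOver hJ ht₀
  refine ⟨γ, ((hm.isTwoHSSolution_iff hJ hJ' ht₀ hγ).1 ⟨h, h0⟩).1, ?_, φ, α, hm, hφ0, hγ⟩
  have := hγ t₀ ht₀
  rw [hρ, hθ] at this
  exact this.unique hq

theorem CotangentDens.Represents.add_const {q : CotangentDens} {ρ θ : ℝ → ℝ}
    (h : q.Represents ρ θ) (c : ℝ) : q.Represents ρ fun x => θ x + c := by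
  obtain ⟨q', hq'⟩ := exists_represents h.contDiff_density h.periodic_density h.pos
    h.integral_eq_one (h.contDiff_fibre.add (contDiff_const (c := c)))
    (fun x => by simp [h.periodic_fibre x])
  rwa [← hq'.eq_of_fibre_eq_add h fun _ => rfl]

/-- Every smooth curve in `T^*Dens(S¹)` lies under a motion that fixes the base point and whose
vertical velocity has zero mean. -/
theorem IsSmoothRep.exists_isMotion {J : Set ℝ} (hJ : IsOpen J) (hJ' : J.OrdConnected)
    {t₀ : ℝ} (ht₀ : t₀ ∈ J) {γ : ℝ → CotangentDens} {ρ θ : ℝ → ℝ → ℝ} (h : IsSmoothRep J γ ρ θ) :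
    ∃ φ α u σ : ℝ → ℝ → ℝ, IsMotion J φ α u σ ∧ LiesOver J φ α γ ∧ φ t₀ 0 = 0 ∧
      (∀ t ∈ J, u t 0 = 0) ∧ ∀ t ∈ J, ∫ x in (0 : ℝ)..1, σ t x = 0 := by
  obtain ⟨hρ, hθ, hrep⟩ := h
  change SmoothOnStrip J ρ at hρ
  change SmoothOnStrip J θ at hθ
  -- Basing the primitive at `0` for every `t` makes `φ t` fix `0`, which gives `u t 0 = 0`.
  set φ : ℝ → ℝ → ℝ := fun t x => ∫ y in (0 : ℝ)..x, ρ t y with hφ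
  have hφs : SmoothOnStrip J φ := hρ.primitive_space hJ
  have hφd : ∀ t ∈ J, partialSpace φ t = ρ t := fun t ht => funext fun x =>
    ((hρ.continuous_slice ht).integral_hasStrictDerivAt 0 x).hasDerivAt.deriv
  have hφ0 : ∀ t, φ t 0 = 0 := fun t => by simp [hφ]
  have hφ1 : ∀ t ∈ J, ∀ x, φ t (x + 1) = φ t x + 1 := fun t ht =>
    (hrep t ht).periodic_density.primitive_add_one (hρ.continuous_slice ht)
      (hrep t ht).integral_eq_one
  have hφpos : ∀ t ∈ J, ∀ x, 0 < partialSpace φ t x := fun t ht x => by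
    rw [hφd t ht]
    exact (hrep t ht).pos x
  have hm := contDiffOn_meanRate hJ hρ hθ
  -- With this correction `α̇` equals the normalized rate, whose zero integral against `ρ dx`
  -- becomes zero mean of `σ`.
  set k : ℝ → ℝ := fun t => -∫ s in t₀..t, meanRate ρ θ s with hk
  set α : ℝ → ℝ → ℝ := fun t x => θ t x + k t with hα
  have hks : SmoothOnStrip J fun t _ => k t :=
    (((SmoothOnStrip.of_time hm).primitive_time hJ hJ' ht₀).const_mul (-1)).congr
      fun t _ x => by simp [hk]
  have hkd : ∀ t ∈ J, HasDerivAt k (-meanRate ρ θ t) t := fun t ht =>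
    (hasDerivAt_primitive hJ hJ' hm.continuousOn ht₀ ht).neg
  have hαs : SmoothOnStrip J α := hθ.add hks
  have hαd : ∀ t ∈ J, ∀ x, partialTime α t x = normalizedRate ρ θ t x := fun t ht x =>
    ((hθ.hasDerivAt_time hJ ht x).add (hkd t ht)).deriv
  obtain ⟨ψ, hψ, hinv⟩ := hφs.exists_inverse hJ hφ1 hφpos
  have hmot : IsMotion J φ α (fun t y => partialTime φ t (ψ t y))
      (fun t y => partialTime α t (ψ t y)) :=
    ⟨hφs, hαs, hφ1, hφpos, fun t ht x => by simp only [hα, (hrep t ht).periodic_fibre x],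
      fun t ht x => by simp only [(hinv t ht x).2, partialTime],
      fun t ht x => by simp only [(hinv t ht x).2, partialTime]⟩
  refine ⟨φ, α, _, _, hmot, fun t ht => ?_, hφ0 t₀, fun t ht => ?_, fun t ht => ?_⟩
  · change (γ t).Represents (partialSpace φ t) (α t)
    rw [hφd t ht]
    exact (hrep t ht).add_const (k t)
  · have h1 := (hinv t ht 0).2
    rw [hφ0] at h1
    simp only [h1, partialTime, hφ0, deriv_const]
  · rw [← hmot.meanRate_eq hJ ht, meanRate, hφd t ht, intervalIntegral.integral_congr
      (g := fun x => normalizedRate ρ θ t x * ρ t x) fun x _ => by simp only [hαd t ht]]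
    exact integral_normalizedRate_mul hJ hρ hθ ht (hrep t ht).integral_eq_one

theorem mainTheorem9 (J : Set ℝ) (hJ : IsOpen J) (hJ' : J.OrdConnected) (t₀ : ℝ) (ht₀ : t₀ ∈ J) :
    (∀ (φ α u σ : ℝ → ℝ → ℝ) (γ : ℝ → CotangentDens),
      IsMotion J φ α u σ → LiesOver J φ α γ →
      ((IsTwoHSSolution J u σ ∧ ∫ x in (0 : ℝ)..1, σ t₀ x = 0) ↔
        (IsSasakiGeodesic J γ ∧ ∀ t ∈ J, ∫ x in (0 : ℝ)..1, σ t x = 0))) ∧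
    (∀ u σ : ℝ → ℝ → ℝ, IsTwoHSSolution J u σ → ∫ x in (0 : ℝ)..1, σ t₀ x = 0 →
      ∀ q : CotangentDens, ∃ γ : ℝ → CotangentDens,
        (IsSasakiGeodesic J γ ∧ γ t₀ = q ∧ Generates J t₀ u σ γ) ∧
        ∀ γ' : ℝ → CotangentDens, γ' t₀ = q → Generates J t₀ u σ γ' → ∀ t ∈ J, γ' t = γ t) ∧
    (∀ γ : ℝ → CotangentDens, IsSasakiGeodesic J γ → ∃ u σ : ℝ → ℝ → ℝ,
      (IsTwoHSSolution J u σ ∧ ∫ x in (0 : ℝ)..1, σ t₀ x = 0 ∧ (∀ t ∈ J, u t 0 = 0) ∧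
        Generates J t₀ u σ γ) ∧
      ∀ u' σ' : ℝ → ℝ → ℝ, IsTwoHSSolution J u' σ' → ∫ x in (0 : ℝ)..1, σ' t₀ x = 0 →
        (∀ t ∈ J, u' t 0 = 0) → Generates J t₀ u' σ' γ →
        ∀ t ∈ J, ∀ x, u' t x = u t x ∧ σ' t x = σ t x) := by
  refine ⟨fun φ α u σ γ hm hγ => hm.isTwoHSSolution_iff hJ hJ' ht₀ hγ, fun u σ h h0 q => ?_,
    fun γ hγ => ?_⟩
  · obtain ⟨γ, hγ, hq, φ, α, hm, hφ, hl⟩ := exists_geodesic_of_isTwoHSSolution hJ hJ' ht₀ h h0 q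
    refine ⟨γ, ⟨hγ, hq, φ, α, hm, hφ, hl⟩, ?_⟩
    rintro γ' hq' ⟨φ', α', hm', hφ', hl'⟩ t ht
    exact hm.liesOver_unique hJ hJ' ht₀ hm' (hφ.trans hφ'.symm) hl hl' (hq'.trans hq.symm) ht
  · obtain ⟨ρ, θ, hrep⟩ := hγ.1
    obtain ⟨φ, α, u, σ, hm, hl, hφ, hu0, hσ0⟩ := hrep.exists_isMotion hJ hJ' ht₀
    obtain ⟨hS, hS0⟩ := (hm.isTwoHSSolution_iff hJ hJ' ht₀ hl).2 ⟨hγ, hσ0⟩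
    refine ⟨u, σ, ⟨hS, hS0, hu0, φ, α, hm, hφ, hl⟩, ?_⟩
    rintro u' σ' hS' hS0' hu0' ⟨φ', α', hm', hφ', hl'⟩ t ht x
    -- For the competing solution, zero mean is known only at `t₀`; the equivalence for motions
    -- extends it to all of `J`.
    exact hm.velocity_unique hJ hJ' ht₀ hm' hu0 hu0' hσ0
      ((hm'.isTwoHSSolution_iff hJ hJ' ht₀ hl').1 ⟨hS', hS0'⟩).2 hφ hφ' hl hl' ht x
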